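/- All graphs are finite, simple and unweighted; $d=d_G$ is the graph distance and the length of a path is its number of edges. A graph is series-parallel if it has no $K_4$ minor, and it has unique shortest paths if any two vertices are joined by at most one shortest path. **Hammock decompositions.** Let $G=(V,E)$ be a graph, $r\in V$, and $T$ a BFS tree of $G$ rooted at $r$, i.e. a spanning tree with $d_T(r,v)=d_G(r,v)$ for all $v$. Ancestors, parents and least common ancestors (lca) refer to $T$ rooted at $r$; edges in $E\setminus E(T)$ are cross edges. A *hammock* $H$ is an induced subgraph $G[V_1\sqcup V_2]$ that consists of two subtrees $T[V_1]$, $T[V_2]$ of $T$ together with the cross edges between $V_1$ and $V_2$, of which there is at least one, such that the highest vertices of the two subtrees (the hammock roots) are not ancestors of one another. A family $\mathcal H=\{H_i\}$ of pairwise edge-disjoint hammocks, with hammock roots $r_i,r_i'$, is a *rooted forest of hammocks* if every simple cycle of $G[\mathcal H]=\bigcup_i H_i$ has edges in exactly one $H_i$ and among the hammocks of each connected component of $G[\mathcal H]$ exactly one is designated as its root hammock. For a hammock $H_j$ that is not the root hammock $H_k$ of its component, the *parent* of $H_j$ is $H_k$ if $H_j$ and $H_k$ share a vertex, and otherwise it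 is the hammock containing the first edge of a path in $G[\mathcal H]$ from $H_j$ to $H_k$ (a path whose only vertex in $H_j$ is its first and whose only vertex in $H_k$ is its last). A *hammock decomposition* of $G$ with respect to $(r,T)$ consists of a subtree $T_0$ of $T$ containing $r$ and a rooted forest of hammocks $\mathcal H$ such that 1. $E=E(T_0)\sqcup E(\mathcal H)\sqcup E_p$, where $E_p$ is the set of the parent edges in $T$ of the vertices $r_i'$; 2. if $H_i$ is the parent of $H_j$, then $V(H_i)\cap V(H_j)=\{r_j\}$, the parent of $r_j'$ in $T$ is $\mathrm{lca}(r_j,r_j')$, and $\mathrm{lca}(r_j,r_j')\in V(H_i)\cup\{\mathrm{lca}(r_i,r_i')\}$; 3. if $H_k$ is a root hammock, then $r_k\in V(T_0)$, and $\mathrm{lca}(r_k,r_k')$ is the parent in $T$ of both $r_k$ and $r_k'$ and lies in $V(T_0)$; 4. every shortest path of $G$ whose first and last edges are cross edges is contained in $G[\mathcal H]$. **Chops.** For $0\le c<1$ and $\Delta\ge 1$, a *$c$-fuzzy $\Delta$-chop* of $G$ with respect to $r$ is a partition of $V$ into (possibly empty) sets $A_1,A_2,\dots$ with $(i-1)\Delta-\frac{c\Delta}2\le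 d(r,v)<i\Delta+\frac{c\Delta}2$ for all $i$ and all $v\in A_i$. It is *$\tau$-scattering* if every shortest path of $G$ of length at most $\Delta$ has at most $\tau$ edges whose endpoints lie in different sets $A_i$. **Lemma.** There are absolute constants $0\le c<1$ and $\tau\in\mathbb N$ such that the following holds. Let $G$ be a series-parallel graph with unique shortest paths, let $r$ be any vertex of $G$ and $T$ a BFS tree of $G$ rooted at $r$, and suppose that $G$ has a hammock decomposition with respect to $(r,T)$. Then for every real $\Delta\ge 1$ there is a $\tau$-scattering $c$-fuzzy $\Delta$-chop of $G$ with respect to $r$. -/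

import Mathlib

namespace HammockScattering

variable {V ι : Type*}

/-! ### Graphs, series-parallel graphs, shortest paths -/

/-- `G` has `K₄` as a minor: there are four pairwise disjoint connected vertex sets
(the supernodes), any two of which are joined by an edge of `G`. -/
def HasK4Minor (G : SimpleGraph V) : Prop :=
  ∃ S : Fin 4 → Set V,
    (∀ i, (G.induce (S i)).Connected) ∧
    (∀ i j, i ≠ j → Disjoint (S i) (S j)) ∧
    (∀ i j, i ≠ j → ∃ u ∈ S i, ∃ v ∈ S j, G.Adj u v)

/-- Series-parallel graphs, i.e. the graphs without a `K₄` minor (equivalently, all biconnected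
components arise from single edges by series and parallel compositions). -/
def SeriesParallel (G : SimpleGraph V) : Prop := ¬ HasK4Minor G

/-- A walk is a shortest path if its length (number of edges) is the distance of its ends. -/
def IsShortestPath (G : SimpleGraph V) {u v : V} (p : G.Walk u v) : Prop :=
  p.length = G.dist u v

/-- Between any two vertices there is at most one shortest path. -/
def UniqueShortestPaths (G : SimpleGraph V) : Prop :=
  ∀ (u v : V) (p q : G.Walk u v), IsShortestPath G p → IsShortestPath G q → p = q

/-! ### BFS trees -/

/-- `T` is a BFS tree of `G` rooted at `r`: a spanning tree of `G` that preserves all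
distances from `r`. -/
structure IsBFSTree (G T : SimpleGraph V) (r : V) : Prop where
  le : T ≤ G
  isTree : T.IsTree
  dist_eq : ∀ v, T.dist r v = G.dist r v

/-- `u` is an ancestor of `v` or equal to `v` in the tree `T` rooted at `r`:
`u` lies on the path of `T` from `r` to `v`. -/
def AncEq (T : SimpleGraph V) (r u v : V) : Prop :=
  ∃ p : T.Walk r v, p.IsPath ∧ u ∈ p.support

/-- `p` is the parent of `v` in the tree `T` rooted at `r`. -/
def IsTreeParent (T : SimpleGraph V) (r p v : V) : Prop :=
  T.Adj p v ∧ AncEq T r p v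

/-- `l` is the least common ancestor of `u` and `v` in the tree `T` rooted at `r`. -/
def IsLca (T : SimpleGraph V) (r l u v : V) : Prop :=
  AncEq T r l u ∧ AncEq T r l v ∧ ∀ x, AncEq T r x u → AncEq T r x v → AncEq T r x l

/-- `x` is the highest vertex of `S`: it lies in `S` and is an ancestor of (or equal to)
every vertex of `S`. -/
def IsHigh (T : SimpleGraph V) (r x : V) (S : Set V) : Prop :=
  x ∈ S ∧ ∀ y ∈ S, AncEq T r x y

/-! ### Hammocks and forests of hammocks -/

/-- The vertex sets `V₁`, `V₂` are those of the two hammock trees, with roots `r₁`, `r₂`, of a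
hammock: two disjoint subtrees of the BFS tree `T` with unrelated roots, together with all cross
edges between them, of which there is at least one. The hammock is the induced subgraph
`G[V₁ ∪ V₂]`, so `G` has no cross edge inside `V₁` or inside `V₂`. -/
structure IsHammock (G T : SimpleGraph V) (r : V) (V₁ V₂ : Set V) (r₁ r₂ : V) : Prop where
  disjoint : Disjoint V₁ V₂
  connected₁ : (T.induce V₁).Connected
  connected₂ : (T.induce V₂).Connected
  high₁ : IsHigh T r r₁ V₁
  high₂ : IsHigh T r r₂ V₂
  unrelated : ¬ AncEq T r r₁ r₂ ∧ ¬ AncEq T r r₂ r₁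
  cross : ∃ u ∈ V₁, ∃ v ∈ V₂, G.Adj u v ∧ ¬ T.Adj u v
  inner₁ : ∀ u ∈ V₁, ∀ v ∈ V₁, G.Adj u v → T.Adj u v
  inner₂ : ∀ u ∈ V₂, ∀ v ∈ V₂, G.Adj u v → T.Adj u v

/-- A family `(Hᵢ)` of pairs of vertex sets with a marked vertex in each: `tree i`, `tree' i` are
the vertex sets of the hammock trees `Tᵢ`, `Tᵢ'` and `root i`, `root' i` the hammock roots
`rᵢ`, `rᵢ'`; `rootHammocks` is the set of hammocks designated as root hammocks. -/
structure HammockFamily (V ι : Type*) where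
  tree : ι → Set V
  tree' : ι → Set V
  root : ι → V
  root' : ι → V
  rootHammocks : Set ι

namespace HammockFamily

variable (F : HammockFamily V ι)

/-- The vertex set `V(Hᵢ)`. -/
def verts (i : ι) : Set V := F.tree i ∪ F.tree' i

/-- The induced subgraph `Hᵢ = G[V(Hᵢ)]` (as a graph on all of `V`). -/
def graph (G : SimpleGraph V) (i : ι) : SimpleGraph V where
  Adj u v := G.Adj u v ∧ u ∈ F.verts i ∧ v ∈ F.verts i
  symm := ⟨fun _ _ h => ⟨h.1.symm, h.2.2, h.2.1⟩⟩
  loopless := ⟨fun _ h => h.1.ne rfl⟩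

/-- The union `G[ℋ]` of all the hammocks (as a graph on all of `V`). -/
def union (G : SimpleGraph V) : SimpleGraph V := ⨆ i, F.graph G i

/-- `Hᵢ` and `Hⱼ` lie in the same connected component of `G[ℋ]`. -/
def SameComponent (G : SimpleGraph V) (i j : ι) : Prop :=
  ∃ u ∈ F.verts i, ∃ v ∈ F.verts j, (F.union G).Reachable u v

/-- The family is a rooted forest of hammocks: its members are pairwise edge-disjoint hammocks,
every simple cycle of `G[ℋ]` has edges in exactly one hammock, and among the hammocks of each
connected component of `G[ℋ]` exactly one is designated as the root hammock. -/
structure IsRootedForest (G T : SimpleGraph V) (r : V) : Prop where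
  isHammock : ∀ i, IsHammock G T r (F.tree i) (F.tree' i) (F.root i) (F.root' i)
  edge_disjoint : ∀ i j, i ≠ j → Disjoint (F.graph G i).edgeSet (F.graph G j).edgeSet
  cycle : ∀ (v : V) (p : (F.union G).Walk v v), p.IsCycle →
    ∃! i, ∃ e ∈ p.edges, e ∈ (F.graph G i).edgeSet
  exists_root : ∀ i, ∃! k, k ∈ F.rootHammocks ∧ F.SameComponent G i k

/-- `Hᵢ` is the parent of `Hⱼ`. Let `Hₖ` be the root hammock of the component of `Hⱼ`, `j ≠ k`.
If `Hⱼ` shares a vertex with `Hₖ`, its parent is `Hₖ`. Otherwise its parent is the hammock that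
contains the first edge of a path of `G[ℋ]` from `Hⱼ` to `Hₖ`, that is, of a path whose only
vertex in `Hⱼ` is its first and whose only vertex in `Hₖ` is its last one. -/
def IsParent (G : SimpleGraph V) (i j : ι) : Prop :=
  ∃ k ∈ F.rootHammocks, j ≠ k ∧ F.SameComponent G j k ∧
    ((i = k ∧ (F.verts j ∩ F.verts k).Nonempty) ∨
      (¬ (F.verts j ∩ F.verts k).Nonempty ∧
        ∃ (x z y : V) (h : (F.union G).Adj x z) (q : (F.union G).Walk z y),
          (SimpleGraph.Walk.cons h q).IsPath ∧ x ∈ F.verts j ∧ y ∈ F.verts k ∧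
          (∀ w ∈ q.support, w ∉ F.verts j) ∧
          (∀ w ∈ q.support, w ∈ F.verts k → w = y) ∧
          (F.graph G i).Adj x z))

/-- The rooted forest of hammocks is lca-respecting with base tree `T[B]`. -/
structure IsLcaRespecting (G T : SimpleGraph V) (r : V) (B : Set V) : Prop where
  inter_eq : ∀ i j, F.IsParent G i j → F.verts i ∩ F.verts j = {F.root j}
  lca : ∀ i j, F.IsParent G i j → ∃ l, IsLca T r l (F.root j) (F.root' j) ∧
    IsTreeParent T r l (F.root' j) ∧ (l ∈ F.verts i ∨ IsLca T r l (F.root i) (F.root' i))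
  base_root : ∀ k ∈ F.rootHammocks, F.root k ∈ B
  base_lca : ∀ k ∈ F.rootHammocks, ∃ l, IsLca T r l (F.root k) (F.root' k) ∧
    IsTreeParent T r l (F.root k) ∧ IsTreeParent T r l (F.root' k) ∧ l ∈ B

/-- The edge set `E(ℋ)`. -/
def edges (G : SimpleGraph V) : Set (Sym2 V) := ⋃ i, (F.graph G i).edgeSet

/-- The set `E_p` of the parent edges in `T` of the hammock roots `rᵢ'`. -/
def parentEdges (T : SimpleGraph V) (r : V) : Set (Sym2 V) :=
  {e | ∃ i p, IsTreeParent T r p (F.root' i) ∧ e = s(p, F.root' i)}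

end HammockFamily

/-- The edges of the induced subgraph `T[B]`. -/
def baseEdges (T : SimpleGraph V) (B : Set V) : Set (Sym2 V) :=
  {e | e ∈ T.edgeSet ∧ ∀ v ∈ e, v ∈ B}

/-- A hammock decomposition of `G` with root `r` and BFS tree `T`: the edges of `G` are
partitioned into those of a subtree `T₀ = T[B]` of `T` containing `r`, those of an lca-respecting
rooted forest of hammocks `F` with base tree `T₀`, and the parent edges of the roots `rᵢ'`; and
every shortest path of `G` whose first and last edges are cross edges is contained in `G[ℋ]`. -/
structure IsHammockDecomposition (G T : SimpleGraph V) (r : V) (B : Set V)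
    (F : HammockFamily V ι) : Prop where
  root_mem : r ∈ B
  base_connected : (T.induce B).Connected
  forest : F.IsRootedForest G T r
  lcaRespecting : F.IsLcaRespecting G T r B
  crossPaths : ∀ (u v : V) (p : G.Walk u v), IsShortestPath G p →
    ∀ e f, p.edges.head? = some e → p.edges.getLast? = some f →
      e ∉ T.edgeSet → f ∉ T.edgeSet → ∀ g ∈ p.edges, g ∈ F.edges G
  edges_eq : G.edgeSet = baseEdges T B ∪ F.edges G ∪ F.parentEdges T r
  disjoint₁ : Disjoint (baseEdges T B) (F.edges G)
  disjoint₂ : Disjoint (baseEdges T B) (F.parentEdges T r)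
  disjoint₃ : Disjoint (F.edges G) (F.parentEdges T r)

/-! ### Scattering chops -/

/-- `A` is a `c`-fuzzy `Δ`-chop of `G` with root `r`: a partition of the vertices into fuzzy
annuli (some may be empty). Here `A i` is the `(i + 1)`-st annulus, `i = 0, 1, 2, …`. -/
structure IsFuzzyChop (G : SimpleGraph V) (r : V) (c Δ : ℝ) (A : ℕ → Set V) : Prop where
  partition : ∀ v, ∃! i, v ∈ A i
  lower : ∀ i, ∀ v ∈ A i, (i : ℝ) * Δ - c * Δ / 2 ≤ (G.dist r v : ℝ)
  upper : ∀ i, ∀ v ∈ A i, (G.dist r v : ℝ) < ((i : ℝ) + 1) * Δ + c * Δ / 2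

/-- The edge `e` has its endpoints in different parts of `A`. -/
def IsCut (A : ℕ → Set V) (e : Sym2 V) : Prop :=
  ∃ u v i j, e = s(u, v) ∧ u ∈ A i ∧ v ∈ A j ∧ i ≠ j

/-- Every shortest path of length at most `Δ` has at most `τ` edges cut by `A`. -/
def IsScattering (G : SimpleGraph V) (Δ : ℝ) (τ : ℕ) (A : ℕ → Set V) : Prop :=
  ∀ (u v : V) (p : G.Walk u v), IsShortestPath G p → (p.length : ℝ) ≤ Δ →
    {e | e ∈ p.edges ∧ IsCut A e}.ncard ≤ τ

end HammockScattering

namespace HammockScattering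

variable {V ι : Type*}

/-! ### Geodesics as vertex sequences -/

/-! The slack of a fuzzy chop is spent on hysteresis. Around each depth $(k+1)\Delta$ lies a window
$[lo, hi)$ of width $\Delta/2$, and the set `Deep` of vertices beyond that boundary contains
everything at depth at least $hi$ and nothing above depth $lo$. Inside the window, membership in a
hammock $H_j$ copies the state of a traveller who starts at $r_j$ with the state of $r_j$, takes the
shortest way inside $H_j$ (down $T_j$, over one cross edge, up and then down $T_j'$), switches on
only at depth at least $hi$ and switches off only at depth below $lo$.

Two properties make this set useful. It is closed under passing to children in $T$
(`Setup.deep_of_par`), so a climbing or descending run is cut at most once; the lca conditions of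
the decomposition are what carries this across the parent edges of the $r_j'$. And along a geodesic
leaving a hammock root inside its hammock the switching rule really holds (`Setup.hysteresis`).
Opposite switches are then at least $hi-lo$ apart, so at most two fit into length $\Delta =
2(hi-lo)$ (`cuts_le_two_of_hysteresis`).

Unique shortest paths enter throughout: they force $T$ to be the tree of unique upward neighbours,
so that ancestry is a distance equation and cross edges are exactly the horizontal edges.

A geodesic is split at its first and last cross edge. The two outer pieces climb and then descend:
at most 2 cuts each. The middle piece lies in $G[\mathcal H]$, where tree-likeness of the forest
splits it into an ascent through hammock roots, a stretch inside one hammock, and a descent. Ascent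
and descent obey hysteresis, with at most 2 cuts each. The stretch has at most 2 cross edges, since
three would give a $K_4$ minor (`IsHam.hasK4Minor`), hence at most $3\cdot 2+2=8$ cuts. This makes
$2+12+2=16$ cuts per window (`Setup.cuts_le`). Only three windows are within reach of a path of
length $\Delta$, so $\tau = 48$ and $c = 1/2$ suffice. -/

/-- `f` is a geodesic of `G` on the interval `[a, b]` of indices. -/
def Geod (G : SimpleGraph V) (f : ℕ → V) (a b : ℕ) : Prop :=
  ∀ i j, a ≤ i → i ≤ j → j ≤ b → G.dist (f i) (f j) + i = j

/-- A connected graph with unique shortest paths. -/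
structure UniqueGeod (G : SimpleGraph V) : Prop where
  conn : G.Connected
  uniq : UniqueShortestPaths G

section Geod

variable {G : SimpleGraph V} {f : ℕ → V} {a b : ℕ}

theorem Geod.mono (h : Geod G f a b) {a' b' : ℕ} (ha : a ≤ a') (hb : b' ≤ b) : Geod G f a' b' :=
  fun i j hi hij hj => h i j (ha.trans hi) hij (hj.trans hb)

theorem Geod.adj (h : Geod G f a b) {i : ℕ} (hi : a ≤ i) (hb : i < b) :
    G.Adj (f i) (f (i + 1)) := by
  have := h i (i + 1) hi (by omega) (by omega)
  exact SimpleGraph.dist_eq_one_iff_adj.1 (by omega)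

theorem Geod.inj (h : Geod G f a b) {i j : ℕ} (hi : a ≤ i) (hib : i ≤ b) (hj : a ≤ j)
    (hjb : j ≤ b) (e : f i = f j) : i = j := by
  rcases le_total i j with hij | hij
  · have := h i j hi hij hjb
    rw [e, SimpleGraph.dist_self] at this
    omega
  · have := h j i hj hij hib
    rw [e, SimpleGraph.dist_self] at this
    omega

theorem Geod.shift (h : Geod G f a b) {c n : ℕ} (hc : a ≤ c) (hn : c + n ≤ b) :
    Geod G (fun t => f (c + t)) 0 n := by
  intro i j _ hij hj
  have := h (c + i) (c + j) (by omega) (by omega) (by omega)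
  simp only
  omega

theorem Geod.reverse (h : Geod G f a b) {c n : ℕ} (hc : c ≤ b) (hn : a + n ≤ c) :
    Geod G (fun t => f (c - t)) 0 n := by
  intro i j _ hij hj
  have := h (c - j) (c - i) (by omega) (by omega) (by omega)
  simp only
  rw [SimpleGraph.dist_comm]
  omega

/-- A sequence of successively adjacent vertices is a walk. -/
theorem exists_walk_of_adj (G : SimpleGraph V) (f : ℕ → V) (a n : ℕ)
    (h : ∀ i < n, G.Adj (f (a + i)) (f (a + i + 1))) :
    ∃ p : G.Walk (f a) (f (a + n)),
      p.edges = (List.range n).map (fun i => s(f (a + i), f (a + i + 1))) ∧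
      p.support = (List.range (n + 1)).map (fun i => f (a + i)) := by
  induction n with
  | zero => exact ⟨.nil, by simp, by simp⟩
  | succ n ih =>
    obtain ⟨p, hp, hs⟩ := ih fun i hi => h i (by omega)
    refine ⟨p.concat (h n (by omega)), ?_, ?_⟩
    · rw [SimpleGraph.Walk.edges_concat, hp, List.range_succ (n := n)]
      simp [add_assoc]
    · rw [SimpleGraph.Walk.support_concat, hs, List.range_succ (n := n + 1)]
      simp

/-- A point of the metric interval between the ends of a geodesic lies on it. -/
theorem Geod.eq_of_dist_le (hG : UniqueGeod G) (h : Geod G f a b) (hab : a ≤ b) {y : V}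
    (hy : G.dist (f a) y + G.dist y (f b) + a ≤ b) : y = f (a + G.dist (f a) y) := by
  obtain ⟨n, rfl⟩ := Nat.exists_eq_add_of_le hab
  obtain ⟨p, -, hs⟩ := exists_walk_of_adj G f a n
    fun i hi => h.adj (by omega) (by omega)
  have hd := h a (a + n) le_rfl (by omega) le_rfl
  -- Joining shortest walks through `y` gives a second shortest path between the ends; by uniqueness
  -- it is `p`, so `y` can be read off at its position on `p`.
  obtain ⟨p₁, h₁⟩ := hG.conn.exists_walk_length_eq_dist (f a) y
  obtain ⟨p₂, h₂⟩ := hG.conn.exists_walk_length_eq_dist y (f (a + n))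
  have hpl : p.length = n := by
    have := congrArg List.length hs
    simpa using this
  have hq : (p₁.append p₂).length = G.dist (f a) (f (a + n)) := by
    have := G.dist_le (p₁.append p₂)
    rw [SimpleGraph.Walk.length_append] at this ⊢
    omega
  have e := hG.uniq _ _ p (p₁.append p₂) (by rw [IsShortestPath]; omega) hq
  have e' : p.getVert (G.dist (f a) y) = y := by
    rw [e, SimpleGraph.Walk.getVert_append, if_neg (by omega), h₁]
    simp
  have : p.getVert (G.dist (f a) y) = f (a + G.dist (f a) y) := by
    have hlt : G.dist (f a) y < p.support.length := by
      simp only [SimpleGraph.Walk.length_support]; omega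
    rw [← p.support_getElem_eq_getVert hlt]
    simp [hs]
  rw [← this, e']

end Geod

/-! ### Parents and ancestors -/

open Classical in
/-- The neighbour of `v` on a shortest path to `r` (and `r` for `v = r`). -/
noncomputable def par (G : SimpleGraph V) (r v : V) : V :=
  if h : ∃ p, G.Adj p v ∧ G.dist r p + 1 = G.dist r v then h.choose else v

/-- `u` is reached from `v` by iterating `par`. -/
def Anc (G : SimpleGraph V) (r u v : V) : Prop := ∃ i, (par G r)^[i] v = u

section Anc

variable {G : SimpleGraph V} {r : V}

theorem par_spec (hG : UniqueGeod G) {v : V} (hv : v ≠ r) :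
    G.Adj (par G r v) v ∧ G.dist r (par G r v) + 1 = G.dist r v := by
  have h : ∃ p, G.Adj p v ∧ G.dist r p + 1 = G.dist r v := by
    obtain ⟨p, hp⟩ := hG.conn.exists_walk_length_eq_dist v r
    cases p with
    | nil => exact absurd rfl hv
    | @cons _ w _ h q =>
      refine ⟨w, h.symm, ?_⟩
      rw [SimpleGraph.Walk.length_cons] at hp
      have h₁ := G.dist_le q
      have h₂ := hG.conn.dist_triangle (u := v) (v := w) (w := r)
      rw [SimpleGraph.dist_eq_one_iff_adj.2 h] at h₂
      rw [SimpleGraph.dist_comm, SimpleGraph.dist_comm (u := r)]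
      omega
  rw [par, dif_pos h]
  exact h.choose_spec

theorem par_root (G : SimpleGraph V) (r : V) : par G r r = r := by
  rw [par, dif_neg]
  rintro ⟨p, -, h⟩
  simp at h

theorem dist_par (hG : UniqueGeod G) (v : V) :
    G.dist r (par G r v) = G.dist r v - 1 := by
  by_cases hv : v = r
  · subst hv; simp [par_root]
  · have := (par_spec hG hv).2; omega

theorem dist_par_iterate (hG : UniqueGeod G) (v : V) (i : ℕ) :
    G.dist r ((par G r)^[i] v) = G.dist r v - i := by
  induction i with
  | zero => rfl
  | succ i ih => rw [Function.iterate_succ_apply', dist_par hG, ih]; omega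

theorem eq_root_of_dist (hG : UniqueGeod G) {v : V} (h : G.dist r v = 0) : v = r :=
  (hG.conn.dist_eq_zero_iff.1 h).symm

theorem dist_adj_le (hG : UniqueGeod G) {u v : V} (h : G.Adj u v) :
    G.dist r v ≤ G.dist r u + 1 := by
  have := hG.conn.dist_triangle (u := r) (v := u) (w := v)
  rwa [SimpleGraph.dist_eq_one_iff_adj.2 h] at this

theorem dist_iterate_le (hG : UniqueGeod G) (v : V) (i : ℕ) :
    G.dist ((par G r)^[i] v) v ≤ i := by
  induction i with
  | zero => simp
  | succ i ih =>
    rw [Function.iterate_succ_apply']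
    by_cases h : (par G r)^[i] v = r
    · rw [h, par_root, ← h]; omega
    · have := hG.conn.dist_triangle (u := par G r ((par G r)^[i] v)) (v := (par G r)^[i] v) (w := v)
      rw [SimpleGraph.dist_eq_one_iff_adj.2 (par_spec hG h).1] at this
      omega

theorem dist_iterate (hG : UniqueGeod G) (v : V) {i : ℕ} (hi : i ≤ G.dist r v) :
    G.dist ((par G r)^[i] v) v = i := by
  have h₁ := dist_iterate_le hG (r := r) v i
  have h₂ := dist_par_iterate hG (r := r) v i
  have h₃ := hG.conn.dist_triangle (u := r) (v := (par G r)^[i] v) (w := v)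
  omega

/-- The shortest path from `v` to `r` as a geodesic. -/
theorem geod_iterate (hG : UniqueGeod G) (v : V) :
    Geod G (fun t => (par G r)^[t] v) 0 (G.dist r v) := by
  intro i j _ hij hj
  obtain ⟨k, rfl⟩ := Nat.exists_eq_add_of_le hij
  simp only
  rw [add_comm i k, Function.iterate_add_apply, SimpleGraph.dist_comm, dist_iterate hG]
  rw [dist_par_iterate hG]; omega

theorem anc_iff_iterate (hG : UniqueGeod G) {u v : V} :
    Anc G r u v ↔ G.dist r u ≤ G.dist r v ∧ (par G r)^[G.dist r v - G.dist r u] v = u := by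
  constructor
  · rintro ⟨i, rfl⟩
    rw [dist_par_iterate hG]
    refine ⟨by omega, ?_⟩
    by_cases hi : i ≤ G.dist r v
    · congr 2; omega
    · have h₁ : (par G r)^[G.dist r v] v = r :=
        eq_root_of_dist hG (by rw [dist_par_iterate hG]; omega)
      have h₂ : (par G r)^[i] v = r :=
        eq_root_of_dist hG (by rw [dist_par_iterate hG]; omega)
      rw [h₂]
      convert h₁ using 2; omega
  · rintro ⟨-, h⟩; exact ⟨_, h⟩

/-- By uniqueness, the iterates of `par` are the only vertices metrically between `r` and `v`.
Ancestry thus becomes linear arithmetic in distances. -/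
theorem anc_iff_dist (hG : UniqueGeod G) {u v : V} :
    Anc G r u v ↔ G.dist r u + G.dist u v ≤ G.dist r v := by
  constructor
  · rw [anc_iff_iterate hG]
    rintro ⟨h, e⟩
    have := dist_iterate_le hG (r := r) v (G.dist r v - G.dist r u)
    rw [e] at this
    omega
  · intro h
    have hr : (par G r)^[G.dist r v] v = r :=
      eq_root_of_dist hG (by rw [dist_par_iterate hG]; omega)
    have := (geod_iterate hG (r := r) v).eq_of_dist_le hG (Nat.zero_le _) (y := u)
      (by simp only [Function.iterate_zero, id, hr]
          rw [SimpleGraph.dist_comm, SimpleGraph.dist_comm (v := r)]; omega)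
    exact ⟨_, this.symm⟩

theorem Anc.refl (G : SimpleGraph V) (r v : V) : Anc G r v v := ⟨0, rfl⟩

theorem Anc.trans {u v w : V} (h : Anc G r u v) (h' : Anc G r v w) : Anc G r u w := by
  obtain ⟨i, rfl⟩ := h
  obtain ⟨j, rfl⟩ := h'
  exact ⟨i + j, Function.iterate_add_apply _ _ _ _⟩

theorem anc_par (G : SimpleGraph V) (r v : V) : Anc G r (par G r v) v := ⟨1, rfl⟩

theorem anc_root (hG : UniqueGeod G) (v : V) : Anc G r r v :=
  (anc_iff_dist hG).2 (by simp)

theorem Anc.dist_le (hG : UniqueGeod G) {u v : V} (h : Anc G r u v) :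
    G.dist r u ≤ G.dist r v := ((anc_iff_iterate hG).1 h).1

theorem Anc.dist_eq (hG : UniqueGeod G) {u v : V} (h : Anc G r u v) :
    G.dist r u + G.dist u v = G.dist r v := by
  have h₁ := (anc_iff_dist hG).1 h
  have h₂ := hG.conn.dist_triangle (u := r) (v := u) (w := v)
  omega

theorem Anc.eq_of_dist_le (hG : UniqueGeod G) {u v : V} (h : Anc G r u v)
    (hd : G.dist r v ≤ G.dist r u) : u = v := by
  have := h.dist_eq hG
  exact hG.conn.dist_eq_zero_iff.1 (by omega)

theorem Anc.antisymm (hG : UniqueGeod G) {u v : V} (h : Anc G r u v) (h' : Anc G r v u) :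
    u = v := h.eq_of_dist_le hG (h'.dist_le hG)

theorem Anc.anc_of_dist_le (hG : UniqueGeod G) {u u' v : V} (h : Anc G r u v)
    (h' : Anc G r u' v) (hd : G.dist r u ≤ G.dist r u') : Anc G r u u' := by
  obtain ⟨h₁, e₁⟩ := (anc_iff_iterate hG).1 h
  obtain ⟨h₂, e₂⟩ := (anc_iff_iterate hG).1 h'
  refine ⟨G.dist r u' - G.dist r u, ?_⟩
  conv_lhs => rw [← e₂]
  rw [← Function.iterate_add_apply]
  conv_rhs => rw [← e₁]
  congr 2
  rw [e₂]
  omega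

theorem Anc.total (hG : UniqueGeod G) {u u' v : V} (h : Anc G r u v) (h' : Anc G r u' v) :
    Anc G r u u' ∨ Anc G r u' u :=
  (le_total (G.dist r u) (G.dist r u')).imp (h.anc_of_dist_le hG h') (h'.anc_of_dist_le hG h)

theorem Anc.eq_or_anc_par {u v : V} (h : Anc G r u v) : u = v ∨ Anc G r u (par G r v) := by
  obtain ⟨i, rfl⟩ := h
  cases i with
  | zero => exact .inl rfl
  | succ i => exact .inr ⟨i, (Function.iterate_succ_apply _ _ _).symm⟩

/-- A neighbour one level higher is the parent. -/
theorem eq_par_of_adj (hG : UniqueGeod G) {u v : V} (h : G.Adj u v)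
    (hd : G.dist r v = G.dist r u + 1) : u = par G r v := by
  have : Anc G r u v := (anc_iff_dist hG).2 (by rw [SimpleGraph.dist_eq_one_iff_adj.2 h]; omega)
  rcases this.eq_or_anc_par with rfl | h'
  · omega
  · exact h'.eq_of_dist_le hG (by rw [dist_par hG]; omega)

/-- An edge joins a vertex to its parent, or two vertices of the same depth. -/
theorem adj_cases (hG : UniqueGeod G) (r : V) {u v : V} (h : G.Adj u v) :
    (u = par G r v ∧ G.dist r v = G.dist r u + 1) ∨
    (v = par G r u ∧ G.dist r u = G.dist r v + 1) ∨ G.dist r u = G.dist r v := by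
  have h₁ := dist_adj_le hG (r := r) h
  have h₂ := dist_adj_le hG (r := r) h.symm
  rcases Nat.lt_trichotomy (G.dist r u) (G.dist r v) with h' | h' | h'
  · exact .inl ⟨eq_par_of_adj hG h (by omega), by omega⟩
  · exact .inr (.inr h')
  · exact .inr (.inl ⟨eq_par_of_adj hG h.symm (by omega), by omega⟩)

/-- A geodesic ending in an ancestor of its start is vertical. -/
theorem Geod.eq_iterate_of_anc (hG : UniqueGeod G) {f : ℕ → V} {a b : ℕ} (h : Geod G f a b)
    (ha : Anc G r (f b) (f a)) {i : ℕ} (hi : a ≤ i) (hib : i ≤ b) :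
    f i = (par G r)^[i - a] (f a) := by
  have hd := h a b le_rfl (by omega) le_rfl
  have hd' := ha.dist_eq hG
  rw [SimpleGraph.dist_comm (u := f b)] at hd'
  obtain ⟨h₁, e⟩ := (anc_iff_iterate hG).1 ha
  have hk : i - a ≤ G.dist r (f a) := by omega
  have h₂ := dist_iterate hG (r := r) (f a) hk
  have h₃ : Anc G r (f b) ((par G r)^[i - a] (f a)) :=
    ha.anc_of_dist_le hG ⟨_, rfl⟩ (by rw [dist_par_iterate hG]; omega)
  have h₄ := h₃.dist_eq hG
  rw [dist_par_iterate hG, SimpleGraph.dist_comm (u := f b)] at h₄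
  rw [SimpleGraph.dist_comm] at h₂
  have := h.eq_of_dist_le hG (by omega) (y := (par G r)^[i - a] (f a)) (by omega)
  rw [h₂] at this
  rw [this]
  congr 1; omega

/-- A geodesic starting in an ancestor of its end is vertical. -/
theorem Geod.anc_of_anc (hG : UniqueGeod G) {f : ℕ → V} {a b : ℕ} (h : Geod G f a b)
    (ha : Anc G r (f a) (f b)) {i j : ℕ} (hi : a ≤ i) (hij : i ≤ j) (hj : j ≤ b) :
    Anc G r (f i) (f j) ∧ G.dist r (f j) = G.dist r (f i) + (j - i) := by
  have hd := ha.dist_eq hG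
  have h₀ := h a b le_rfl (by omega) le_rfl
  have h₁ := h a i le_rfl hi (by omega)
  have h₂ := h i j hi hij hj
  have h₃ := h j b (by omega) hj le_rfl
  have t₁ := hG.conn.dist_triangle (u := r) (v := f a) (w := f i)
  have t₂ := hG.conn.dist_triangle (u := r) (v := f j) (w := f b)
  have t₃ := hG.conn.dist_triangle (u := r) (v := f i) (w := f j)
  exact ⟨(anc_iff_dist hG).2 (by omega), by omega⟩

end Anc

/-! ### The BFS tree in terms of parents -/

section Tree

variable {G T : SimpleGraph V} {r : V}

theorem uniqueGeod_of_isTree (hT : T.IsTree) : UniqueGeod T where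
  conn := hT.connected
  uniq u v p q hp hq := (hT.existsUnique_path u v).unique
    (p.isPath_of_length_eq_dist hp) (q.isPath_of_length_eq_dist hq)

theorem IsBFSTree.uniqueGeod (hB : IsBFSTree G T r) (hu : UniqueShortestPaths G) :
    UniqueGeod G := ⟨hB.isTree.connected.mono hB.le, hu⟩

theorem length_eq_dist_of_isTree (hT : T.IsTree) {u v : V} {p : T.Walk u v} (hp : p.IsPath) :
    p.length = T.dist u v := by
  obtain ⟨q, hq, hl⟩ := hT.connected.exists_path_of_dist u v
  rw [(hT.existsUnique_path u v).unique hp hq, hl]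

/-- The path to `u` either contains `v`, or extends by the edge to the unique path to `v`, which is
then longer. Consequently a horizontal edge of `G` is never a tree edge. -/
theorem dist_ne_of_adj_of_isTree (hT : T.IsTree) (r : V) {u v : V} (h : T.Adj u v) :
    T.dist r u ≠ T.dist r v := by
  classical
  intro e
  obtain ⟨p, hp, hl⟩ := hT.connected.exists_path_of_dist r u
  by_cases hv : v ∈ p.support
  · have h₁ := congrArg SimpleGraph.Walk.length (p.take_spec hv)
    rw [SimpleGraph.Walk.length_append] at h₁
    have h₂ := T.dist_le (p.takeUntil v hv)
    have h₃ : (p.dropUntil v hv).length = 0 := by omega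
    exact h.ne (SimpleGraph.Walk.eq_of_length_eq_zero h₃).symm
  · have h₁ := length_eq_dist_of_isTree hT (hp.concat hv h)
    rw [SimpleGraph.Walk.length_concat] at h₁
    omega

/-- Two neighbours of `v` one level higher would give two shortest paths to `r`, so there is no
choice in the BFS tree and `T` can be replaced by `par G r`. -/
theorem IsBFSTree.par_eq (hB : IsBFSTree G T r) (hG : UniqueGeod G) (v : V) :
    par T r v = par G r v := by
  by_cases hv : v = r
  · subst hv; rw [par_root, par_root]
  · obtain ⟨h₁, h₂⟩ := par_spec (uniqueGeod_of_isTree hB.isTree) hv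
    rw [hB.dist_eq, hB.dist_eq] at h₂
    exact eq_par_of_adj hG (hB.le h₁) h₂.symm

theorem IsBFSTree.adj_par (hB : IsBFSTree G T r) (hG : UniqueGeod G) {v : V} (hv : v ≠ r) :
    T.Adj (par G r v) v := by
  rw [← hB.par_eq hG]
  exact (par_spec (uniqueGeod_of_isTree hB.isTree) hv).1

theorem IsBFSTree.dist_ne_of_adj (hB : IsBFSTree G T r) {u v : V} (h : T.Adj u v) :
    G.dist r u ≠ G.dist r v := by
  rw [← hB.dist_eq, ← hB.dist_eq]
  exact dist_ne_of_adj_of_isTree hB.isTree r h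

theorem IsBFSTree.adj_cases (hB : IsBFSTree G T r) (hG : UniqueGeod G) {u v : V}
    (h : T.Adj u v) : u = par G r v ∨ v = par G r u := by
  rcases HammockScattering.adj_cases hG r (hB.le h) with h' | h' | h'
  · exact .inl h'.1
  · exact .inr h'.1
  · exact absurd h' (hB.dist_ne_of_adj h)

theorem IsBFSTree.ancEq_iff (hB : IsBFSTree G T r) (hG : UniqueGeod G) {u v : V} :
    AncEq T r u v ↔ Anc G r u v := by
  classical
  have hT := uniqueGeod_of_isTree hB.isTree
  have e : Anc G r u v ↔ Anc T r u v := by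
    rw [Anc, Anc, show par T r = par G r from funext (hB.par_eq hG)]
  rw [e, anc_iff_dist hT]
  constructor
  · rintro ⟨p, hp, hu⟩
    have h₁ := congrArg SimpleGraph.Walk.length (p.take_spec hu)
    rw [SimpleGraph.Walk.length_append, length_eq_dist_of_isTree hB.isTree hp] at h₁
    have h₂ := T.dist_le (p.takeUntil u hu)
    have h₃ := T.dist_le (p.dropUntil u hu)
    omega
  · intro h
    obtain ⟨p₁, h₁⟩ := hT.conn.exists_walk_length_eq_dist r u
    obtain ⟨p₂, h₂⟩ := hT.conn.exists_walk_length_eq_dist u v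
    refine ⟨p₁.append p₂, SimpleGraph.Walk.isPath_of_length_eq_dist _ ?_, by simp⟩
    have := T.dist_le (p₁.append p₂)
    rw [SimpleGraph.Walk.length_append] at this ⊢
    omega

theorem IsBFSTree.isTreeParent (hB : IsBFSTree G T r) (hG : UniqueGeod G) {p v : V}
    (h : IsTreeParent T r p v) : p = par G r v ∧ v ≠ r := by
  have ha := (hB.ancEq_iff hG).1 h.2
  have hp : p = par G r v := by
    rcases ha.eq_or_anc_par with rfl | h'
    · exact absurd rfl h.1.ne
    · rcases hB.adj_cases hG h.1 with e | e
      · exact e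
      · subst e
        exact absurd ((anc_par G r p).antisymm hG ha) h.1.ne'
  refine ⟨hp, ?_⟩
  rintro rfl
  rw [par_root] at hp
  exact h.1.ne hp

/-- A connected vertex set of the tree contains the parents of its vertices, except that of its
highest vertex. -/
theorem IsBFSTree.par_mem (hB : IsBFSTree G T r) (hG : UniqueGeod G) {S : Set V} {ρ v : V}
    (hS : (T.induce S).Connected) (hρ : ρ ∈ S) (hhigh : Anc G r ρ v) (hv : v ∈ S)
    (hne : v ≠ ρ) : par G r v ∈ S := by
  obtain ⟨p⟩ := hS.preconnected ⟨v, hv⟩ ⟨ρ, hρ⟩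
  -- A tree walk from `v` to `ρ` has to leave the set of descendants of `v`, and the only tree edge
  -- doing so joins `v` to its parent.
  obtain ⟨d, -, h₁, h₂⟩ := p.exists_boundary_dart {w | Anc G r v w.1} (Anc.refl G r v)
    (fun h => hne (Anc.antisymm hG h hhigh))
  have hadj : T.Adj d.fst.1 d.snd.1 := d.adj
  simp only [Set.mem_ofPred_eq] at h₁ h₂
  have e : d.snd.1 = par G r d.fst.1 := by
    rcases hB.adj_cases hG hadj with e | e
    · exact absurd (h₁.trans (e ▸ anc_par G r _)) h₂
    · exact e
  rcases h₁.eq_or_anc_par with e' | h'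
  · rw [e', ← e]; exact d.snd.2
  · rw [← e] at h'; exact absurd h' h₂

end Tree

/-! ### Hammocks in terms of parents -/

/-- The properties of one side of a hammock: a subtree with highest vertex `ρ`. -/
structure IsSubtree (G : SimpleGraph V) (r : V) (S : Set V) (ρ : V) : Prop where
  root_mem : ρ ∈ S
  anc : ∀ v ∈ S, Anc G r ρ v
  par_mem : ∀ v ∈ S, v ≠ ρ → par G r v ∈ S
  inner : ∀ u ∈ S, ∀ v ∈ S, G.Adj u v → G.dist r u ≠ G.dist r v

/-- A hammock, in terms of parents. -/
structure IsHam (G : SimpleGraph V) (r : V) (V₁ V₂ : Set V) (r₁ r₂ : V) : Prop where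
  disjoint : ∀ v, v ∈ V₁ → v ∈ V₂ → False
  left : IsSubtree G r V₁ r₁
  right : IsSubtree G r V₂ r₂
  not_anc : ¬ Anc G r r₁ r₂
  not_anc' : ¬ Anc G r r₂ r₁
  cross : ∃ u ∈ V₁, ∃ v ∈ V₂, G.Adj u v

section Ham

variable {G T : SimpleGraph V} {r : V} {V₁ V₂ : Set V} {r₁ r₂ : V}

theorem IsHam.symm (h : IsHam G r V₁ V₂ r₁ r₂) : IsHam G r V₂ V₁ r₂ r₁ where
  disjoint v h₁ h₂ := h.disjoint v h₂ h₁
  left := h.right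
  right := h.left
  not_anc := h.not_anc'
  not_anc' := h.not_anc
  cross := by
    obtain ⟨u, hu, v, hv, huv⟩ := h.cross
    exact ⟨v, hv, u, hu, huv.symm⟩

theorem IsHammock.isHam (hB : IsBFSTree G T r) (hG : UniqueGeod G)
    (h : IsHammock G T r V₁ V₂ r₁ r₂) : IsHam G r V₁ V₂ r₁ r₂ where
  disjoint _ h₁ h₂ := Set.disjoint_left.1 h.disjoint h₁ h₂
  left :=
    { root_mem := h.high₁.1
      anc := fun v hv => (hB.ancEq_iff hG).1 (h.high₁.2 v hv)
      par_mem := fun v hv => hB.par_mem hG h.connected₁ h.high₁.1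
        ((hB.ancEq_iff hG).1 (h.high₁.2 v hv)) hv
      inner := fun u hu v hv huv => hB.dist_ne_of_adj (h.inner₁ u hu v hv huv) }
  right :=
    { root_mem := h.high₂.1
      anc := fun v hv => (hB.ancEq_iff hG).1 (h.high₂.2 v hv)
      par_mem := fun v hv => hB.par_mem hG h.connected₂ h.high₂.1
        ((hB.ancEq_iff hG).1 (h.high₂.2 v hv)) hv
      inner := fun u hu v hv huv => hB.dist_ne_of_adj (h.inner₂ u hu v hv huv) }
  not_anc := fun h' => h.unrelated.1 ((hB.ancEq_iff hG).2 h')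
  not_anc' := fun h' => h.unrelated.2 ((hB.ancEq_iff hG).2 h')
  cross := by
    obtain ⟨u, hu, v, hv, huv, -⟩ := h.cross
    exact ⟨u, hu, v, hv, huv⟩

/-- Between two related vertices of a subtree, the tree path stays in the subtree. -/
theorem IsSubtree.mem_of_anc (hG : UniqueGeod G) {S : Set V} {ρ : V} (h : IsSubtree G r S ρ)
    {u v : V} (hv : v ∈ S) (huv : Anc G r u v) (hρ : Anc G r ρ u) : u ∈ S := by
  obtain ⟨i, rfl⟩ := huv
  induction i with
  | zero => exact hv
  | succ i ih =>
    rw [Function.iterate_succ_apply'] at hρ ⊢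
    have h₁ := ih (hρ.trans (anc_par G r _))
    by_cases e : (par G r)^[i] v = ρ
    · rw [e] at hρ ⊢
      rw [(anc_par G r ρ).antisymm hG hρ]
      exact h.root_mem
    · exact h.par_mem _ h₁ e

/-- The ancestors of a vertex form a chain, so a relation between the two sides would make the
hammock roots comparable. -/
theorem IsHam.not_anc_of_mem (hG : UniqueGeod G) (h : IsHam G r V₁ V₂ r₁ r₂) {u v : V}
    (hu : u ∈ V₁) (hv : v ∈ V₂) : ¬ Anc G r u v := fun huv =>
  (((h.left.anc u hu).trans huv).total hG (h.right.anc v hv)).elim (fun e => h.not_anc e)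
    fun e => h.not_anc' e

/-- Edges between the two sides of a hammock are horizontal. -/
theorem IsHam.dist_eq (hG : UniqueGeod G) (h : IsHam G r V₁ V₂ r₁ r₂) {u v : V}
    (hu : u ∈ V₁) (hv : v ∈ V₂) (huv : G.Adj u v) : G.dist r u = G.dist r v := by
  rcases adj_cases hG r huv with ⟨e, -⟩ | ⟨e, -⟩ | e
  · exact absurd (e ▸ anc_par G r v) (h.not_anc_of_mem hG hu hv)
  · exact absurd (e ▸ anc_par G r u) (h.symm.not_anc_of_mem hG hv hu)
  · exact e

theorem IsHam.ne_root_left (hG : UniqueGeod G) (h : IsHam G r V₁ V₂ r₁ r₂) {v : V}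
    (hv : v ∈ V₁) : v ≠ r := by
  rintro rfl
  exact h.not_anc_of_mem hG hv h.right.root_mem (anc_root hG _)

end Ham

/-! ### Trimming walks -/

section Walk

variable {G : SimpleGraph V}

theorem isPath_append {u v w : V} {p : G.Walk u v} {q : G.Walk v w} (hp : p.IsPath)
    (hq : q.IsPath) (h : ∀ z ∈ p.support, z ∈ q.support → z = v) : (p.append q).IsPath := by
  rw [SimpleGraph.Walk.isPath_def, SimpleGraph.Walk.support_append, List.nodup_append]
  have hq' := hq.support_nodup
  rw [← SimpleGraph.Walk.cons_tail_support, List.nodup_cons] at hq'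
  refine ⟨hp.support_nodup, hq'.2, ?_⟩
  rintro a ha b hb rfl
  exact hq'.1 (h a ha (List.mem_of_mem_tail hb) ▸ hb)

theorem eq_of_mem_takeUntil_of_mem_dropUntil [DecidableEq V] {u v w z : V} {p : G.Walk u v}
    (hp : p.IsPath) (hw : w ∈ p.support) (h₁ : z ∈ (p.takeUntil w hw).support)
    (h₂ : z ∈ (p.dropUntil w hw).support) : z = w := by
  have h := hp.support_nodup
  rw [← p.take_spec hw, SimpleGraph.Walk.support_append, List.nodup_append] at h
  rw [← SimpleGraph.Walk.cons_tail_support, List.mem_cons] at h₂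
  rcases h₂ with h₂ | h₂
  · exact h₂
  · exact absurd rfl (h.2.2 z h₁ z h₂)

/-- The part of a walk after its last visit to `S`. -/
theorem exists_walk_after_last (S : Set V) {a w : V} (p : G.Walk a w)
    (h : ∃ y ∈ p.support, y ∈ S) :
    ∃ x ∈ S, ∃ q : G.Walk x w, q.support ⊆ p.support ∧ (p.IsPath → q.IsPath) ∧
      ∀ y ∈ q.support, y ∈ S → y = x := by
  induction p with
  | nil =>
    obtain ⟨y, hy, hS⟩ := h
    rw [SimpleGraph.Walk.support_nil, List.mem_singleton] at hy
    subst hy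
    exact ⟨y, hS, .nil, by simp, by simp, by simp⟩
  | @cons u v w h' p ih =>
    by_cases hp : ∃ y ∈ p.support, y ∈ S
    · obtain ⟨x, hx, q, h₁, h₂, h₃⟩ := ih hp
      refine ⟨x, hx, q, ?_, fun hp => h₂ hp.of_cons, h₃⟩
      rw [SimpleGraph.Walk.support_cons]
      exact List.subset_cons_of_subset _ h₁
    · push Not at hp
      have hu : u ∈ S := by
        obtain ⟨y, hy, hS⟩ := h
        rw [SimpleGraph.Walk.support_cons, List.mem_cons] at hy
        rcases hy with rfl | hy
        · exact hS
        · exact absurd hS (hp y hy)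
      refine ⟨u, hu, .cons h' p, fun _ h => h, id, fun y hy hS => ?_⟩
      rw [SimpleGraph.Walk.support_cons, List.mem_cons] at hy
      rcases hy with rfl | hy
      · rfl
      · exact absurd hS (hp y hy)

/-- A walk from `S` to `S'` contains a path meeting `S` and `S'` only in its ends. -/
theorem exists_path_between (S S' : Set V) {a b : V} (p : G.Walk a b) (ha : a ∈ S)
    (hb : b ∈ S') :
    ∃ x ∈ S, ∃ y ∈ S', ∃ q : G.Walk x y, q.IsPath ∧ q.support ⊆ p.support ∧
      (∀ z ∈ q.support, z ∈ S → z = x) ∧ ∀ z ∈ q.support, z ∈ S' → z = y := by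
  classical
  obtain ⟨x, hx, q, h₁, h₂, h₃⟩ :=
    exists_walk_after_last S p.bypass ⟨a, SimpleGraph.Walk.start_mem_support _, ha⟩
  obtain ⟨y, hy, q', h₁', h₂', h₃'⟩ :=
    exists_walk_after_last S' q.reverse ⟨b, SimpleGraph.Walk.start_mem_support _, hb⟩
  have hs : ∀ z ∈ q'.reverse.support, z ∈ q.support := by
    intro z hz
    rw [SimpleGraph.Walk.support_reverse, List.mem_reverse] at hz
    have := h₁' hz
    rwa [SimpleGraph.Walk.support_reverse, List.mem_reverse] at this
  refine ⟨x, hx, y, hy, q'.reverse, (h₂' (h₂ p.bypass_isPath).reverse).reverse,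
    fun z hz => p.support_bypass_subset_support (h₁ (hs z hz)), fun z hz => h₃ z (hs z hz), ?_⟩
  intro z hz
  rw [SimpleGraph.Walk.support_reverse, List.mem_reverse] at hz
  exact h₃' z hz

end Walk

/-! ### The forest of hammocks -/

/-- A hammock decomposition of a graph with unique shortest paths. -/
structure Setup (G T : SimpleGraph V) (r : V) (B : Set V) (F : HammockFamily V ι) : Prop where
  tree : IsBFSTree G T r
  geod : UniqueGeod G
  dec : IsHammockDecomposition G T r B F

section Forest

variable {G T : SimpleGraph V} {r : V} {B : Set V} {F : HammockFamily V ι}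

theorem Setup.isHam (h : Setup G T r B F) (j : ι) :
    IsHam G r (F.tree j) (F.tree' j) (F.root j) (F.root' j) :=
  (h.dec.forest.isHammock j).isHam h.tree h.geod

theorem union_adj {u v : V} : (F.union G).Adj u v ↔ ∃ i, (F.graph G i).Adj u v := by
  rw [HammockFamily.union, SimpleGraph.iSup_adj]

theorem union_le : F.union G ≤ G := fun _ _ h => by
  obtain ⟨i, hi⟩ := union_adj.1 h
  exact hi.1

theorem Setup.root_mem (h : Setup G T r B F) (j : ι) : F.root j ∈ F.verts j :=
  .inl (h.isHam j).left.root_mem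

theorem Setup.eq_of_adj (h : Setup G T r B F) {i j : ι} {u v : V} (hi : (F.graph G i).Adj u v)
    (hj : (F.graph G j).Adj u v) : i = j := by
  by_contra hij
  exact Set.disjoint_left.1 (h.dec.forest.edge_disjoint i j hij)
    (show s(u, v) ∈ (F.graph G i).edgeSet from hi) hj

theorem reachable_of_subtree (hG : UniqueGeod G) {j : ι} {S : Set V} {ρ : V}
    (hS : IsSubtree G r S ρ) (hsub : S ⊆ F.verts j) {v : V} (hv : v ∈ S) (hr : r ∈ S → ρ = r) :
    (F.graph G j).Reachable v ρ := by
  induction hn : G.dist r v using Nat.strong_induction_on generalizing v with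
  | _ n ih =>
    by_cases e : v = ρ
    · subst e; exact .refl _
    · have hvr : v ≠ r := fun hvr => e (by subst hvr; exact (hr hv).symm)
      obtain ⟨h₁, h₂⟩ := par_spec hG hvr
      have hp := hS.par_mem v hv e
      refine SimpleGraph.Reachable.trans ?_ (ih _ (by omega) hp rfl)
      exact SimpleGraph.Adj.reachable ⟨h₁.symm, hsub hv, hsub hp⟩

theorem Setup.reachable (h : Setup G T r B F) {j : ι} {a b : V} (ha : a ∈ F.verts j)
    (hb : b ∈ F.verts j) : (F.graph G j).Reachable a b := by
  have hj := h.isHam j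
  have h₁ : ∀ v ∈ F.tree j, (F.graph G j).Reachable v (F.root j) := fun v hv =>
    reachable_of_subtree h.geod hj.left Set.subset_union_left hv
      (fun hr => absurd rfl (hj.ne_root_left h.geod hr))
  have h₂ : ∀ v ∈ F.tree' j, (F.graph G j).Reachable v (F.root' j) := fun v hv =>
    reachable_of_subtree h.geod hj.right Set.subset_union_right hv
      (fun hr => absurd rfl (hj.symm.ne_root_left h.geod hr))
  obtain ⟨u, hu, v, hv, huv⟩ := hj.cross
  have h₃ : (F.graph G j).Reachable (F.root j) (F.root' j) :=
    (h₁ u hu).symm.trans (.trans (SimpleGraph.Adj.reachable ⟨huv, .inl hu, .inr hv⟩) (h₂ v hv))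
  have key : ∀ v ∈ F.verts j, (F.graph G j).Reachable v (F.root j) := by
    rintro v (hv | hv)
    · exact h₁ v hv
    · exact (h₂ v hv).trans h₃.symm
  exact (key a ha).trans (key b hb).symm

theorem support_subset_verts {j : ι} {a b : V} (p : (F.graph G j).Walk a b)
    (ha : a ∈ F.verts j) : ∀ w ∈ p.support, w ∈ F.verts j := by
  induction p with
  | nil => intro w hw; rw [SimpleGraph.Walk.support_nil, List.mem_singleton] at hw; exact hw ▸ ha
  | cons h' p ih =>
    intro w hw
    rw [SimpleGraph.Walk.support_cons, List.mem_cons] at hw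
    rcases hw with rfl | hw
    · exact ha
    · exact ih h'.2.2 w hw

theorem Setup.exists_path (h : Setup G T r B F) {j : ι} {a b : V} (ha : a ∈ F.verts j)
    (hb : b ∈ F.verts j) : ∃ p : (F.union G).Walk a b, p.IsPath ∧
      (∀ w ∈ p.support, w ∈ F.verts j) ∧ ∀ e ∈ p.edges, e ∈ (F.graph G j).edgeSet := by
  obtain ⟨p, hp, -⟩ := (h.reachable ha hb).exists_path_of_dist
  have hle : F.graph G j ≤ F.union G := le_iSup (F.graph G) j
  refine ⟨p.mapLe hle, hp.mapLe hle, ?_, ?_⟩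
  · intro w hw
    rw [SimpleGraph.Walk.support_mapLe_eq_support] at hw
    exact support_subset_verts p ha w hw
  · intro e he
    rw [SimpleGraph.Walk.edges_mapLe_eq_edges] at he
    exact p.edges_subset_edgeSet he

/-- Hammocks are convex with respect to paths of `G[ℋ]`. -/
theorem Setup.convex (h : Setup G T r B F) {j : ι} {a b : V} {p : (F.union G).Walk a b}
    (hp : p.IsPath) (ha : a ∈ F.verts j) (hb : b ∈ F.verts j) :
    ∀ w ∈ p.support, w ∈ F.verts j := by
  classical
  intro w hw
  by_contra hwj
  obtain ⟨x, hx, q₁, hs₁, hp₁, hm₁⟩ := exists_walk_after_last (F.verts j) (p.takeUntil w hw)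
    ⟨a, SimpleGraph.Walk.start_mem_support _, ha⟩
  obtain ⟨y, hy, q₂, hs₂, hp₂, hm₂⟩ := exists_walk_after_last (F.verts j)
    (p.dropUntil w hw).reverse ⟨b, SimpleGraph.Walk.start_mem_support _, hb⟩
  replace hp₁ := hp₁ (hp.takeUntil hw)
  replace hp₂ := hp₂ (hp.dropUntil hw).reverse
  have hcap : ∀ z ∈ q₁.support, z ∈ q₂.support → z = w := by
    intro z h₁ h₂
    refine eq_of_mem_takeUntil_of_mem_dropUntil hp hw (hs₁ h₁) ?_
    have := hs₂ h₂
    rwa [SimpleGraph.Walk.support_reverse, List.mem_reverse] at this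
  -- The excursion outside $H_j$ leaves at `x` and returns at `y`; closing it by a path `R` inside
  -- $H_j$ produces a cycle.
  obtain ⟨R, hR, hRs, hRe⟩ := h.exists_path hy hx
  have hxy : x ≠ y := by
    rintro rfl
    exact hwj (hcap x q₁.start_mem_support q₂.start_mem_support ▸ hx)
  cases q₁ with
  | nil => exact hwj hx
  | @cons _ x' _ hadj q₁ =>
    have hq₁ := SimpleGraph.Walk.cons_isPath_iff hadj q₁ |>.1 hp₁
    have hout : ∀ z ∈ q₁.support, z ∉ F.verts j := by
      intro z hz hzj
      have := hm₁ z (by rw [SimpleGraph.Walk.support_cons]; exact List.mem_cons_of_mem _ hz) hzj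
      exact hq₁.2 (this ▸ hz)
    have hmid : (q₁.append q₂.reverse).IsPath := by
      refine isPath_append hq₁.1 hp₂.reverse fun z h₁ h₂ => ?_
      rw [SimpleGraph.Walk.support_reverse, List.mem_reverse] at h₂
      exact hcap z (by rw [SimpleGraph.Walk.support_cons]; exact List.mem_cons_of_mem _ h₁) h₂
    have hmidout : ∀ z ∈ (q₁.append q₂.reverse).support, z ∈ F.verts j → z = y := by
      intro z hz hzj
      rw [SimpleGraph.Walk.mem_support_append_iff, SimpleGraph.Walk.support_reverse,
        List.mem_reverse] at hz
      rcases hz with hz | hz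
      · exact absurd hzj (hout z hz)
      · exact hm₂ z hz hzj
    have hpath : ((q₁.append q₂.reverse).append R).IsPath :=
      isPath_append hmid hR fun z h₁ h₂ => hmidout z h₁ (hRs z h₂)
    have hx' : x' ∉ F.verts j := hout x' q₁.start_mem_support
    have hcyc : (SimpleGraph.Walk.cons hadj ((q₁.append q₂.reverse).append R)).IsCycle := by
      rw [SimpleGraph.Walk.cons_isCycle_iff]
      refine ⟨hpath, fun he => ?_⟩
      rw [SimpleGraph.Walk.edges_append, List.mem_append] at he
      rcases he with he | he
      · exact hxy (hmidout x (SimpleGraph.Walk.fst_mem_support_of_mem_edges _ he) hx)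
      · exact hx' (hRs x' (SimpleGraph.Walk.snd_mem_support_of_mem_edges _ he))
    obtain ⟨i, hi⟩ := union_adj.1 hadj
    have hRne : R.edges ≠ [] := by
      intro he
      have : R.length = 0 := by rw [← SimpleGraph.Walk.length_edges, he]; rfl
      exact hxy (SimpleGraph.Walk.eq_of_length_eq_zero this).symm
    obtain ⟨e, he⟩ := List.exists_mem_of_ne_nil _ hRne
    -- The cycle has edges of $H_j$ in `R`, so the first edge of the excursion must belong to $H_j$
    -- as well, although it leaves $H_j$.
    have hij : i = j := (h.dec.forest.cycle _ _ hcyc).unique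
      ⟨s(x, x'), by simp, hi⟩ ⟨e, by simp [he], hRe e he⟩
    subst hij
    exact hx' hi.2.2

theorem isParent_of_inter {j k : ι} (hk : k ∈ F.rootHammocks)
    (hjk : j ≠ k) {x : V} (hx : x ∈ F.verts j) (hx' : x ∈ F.verts k) : F.IsParent G k j :=
  ⟨k, hk, hjk, ⟨x, hx, x, hx', .refl _⟩, .inl ⟨rfl, x, hx, hx'⟩⟩

theorem Setup.eq_root_of_inter (h : Setup G T r B F) {i j : ι} (hij : F.IsParent G i j) {x : V}
    (hx : x ∈ F.verts i) (hx' : x ∈ F.verts j) : x = F.root j := by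
  have : x ∈ F.verts i ∩ F.verts j := ⟨hx, hx'⟩
  rwa [h.dec.lcaRespecting.inter_eq i j hij] at this

/-- A walk of `G[ℋ]` from a hammock to a disjoint root hammock yields a parent. -/
theorem Setup.exists_parent_path (h : Setup G T r B F) {j k : ι} (hk : k ∈ F.rootHammocks)
    (hd : ¬ (F.verts j ∩ F.verts k).Nonempty) {a b : V} (p : (F.union G).Walk a b)
    (ha : a ∈ F.verts j) (hb : b ∈ F.verts k) :
    F.root j ∈ p.support ∧ ∃ i z y, F.IsParent G i j ∧ (F.graph G i).Adj (F.root j) z ∧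
      y ∈ F.verts k ∧ ∃ q : (F.union G).Walk z y, F.root j ∉ q.support := by
  obtain ⟨x, hx, y, hy, q, hq, hs, h₁, h₂⟩ := exists_path_between _ _ p ha hb
  have hjk : j ≠ k := by rintro rfl; exact hd ⟨a, ha, ha⟩
  cases q with
  | nil => exact absurd ⟨x, hx, hy⟩ hd
  | @cons _ z _ hadj q =>
    obtain ⟨i, hi⟩ := union_adj.1 hadj
    have hq' := (SimpleGraph.Walk.cons_isPath_iff hadj q).1 hq
    have hsub : ∀ w ∈ q.support, w ∈ (SimpleGraph.Walk.cons hadj q).support := fun w hw => by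
      rw [SimpleGraph.Walk.support_cons]; exact List.mem_cons_of_mem _ hw
    have hpar : F.IsParent G i j := by
      refine ⟨k, hk, hjk, ⟨a, ha, b, hb, ⟨p⟩⟩, .inr ⟨hd, x, z, y, hadj, q, hq, hx, hy, ?_, ?_, hi⟩⟩
      · intro w hw hwj
        exact hq'.2 (h₁ w (hsub w hw) hwj ▸ hw)
      · exact fun w hw => h₂ w (hsub w hw)
    have hxr : x = F.root j := h.eq_root_of_inter hpar hi.2.1 hx
    refine ⟨hxr ▸ hs (SimpleGraph.Walk.start_mem_support _), i, z, y, hpar, hxr ▸ hi, hy, q, ?_⟩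
    exact hxr ▸ hq'.2

/-- A walk of `G[ℋ]` from a hammock to the root hammock passes through the hammock root. -/
theorem Setup.root_mem_support (h : Setup G T r B F) {j k : ι} (hk : k ∈ F.rootHammocks)
    (hjk : j ≠ k) {a b : V} (p : (F.union G).Walk a b) (ha : a ∈ F.verts j)
    (hb : b ∈ F.verts k) : F.root j ∈ p.support := by
  by_cases hd : (F.verts j ∩ F.verts k).Nonempty
  · obtain ⟨w, hw, hw'⟩ := hd
    have hpar := isParent_of_inter (G := G) hk hjk hw hw'
    have hwr := h.eq_root_of_inter hpar hw' hw
    obtain ⟨x, hx, y, hy, q, hq, hs, h₁, h₂⟩ := exists_path_between _ _ p ha hb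
    -- Continuing from the entry point `y` inside $H_k$ to the shared vertex `w` gives a path with
    -- both ends in $H_j$; convexity puts `y` in both hammocks, and their only common vertex is the
    -- root.
    obtain ⟨R, hR, hRs, -⟩ := h.exists_path hy hw'
    have hpath := isPath_append hq hR fun z hz hz' => h₂ z hz (hRs z hz')
    have hyj := h.convex hpath hx hw y
      (by rw [SimpleGraph.Walk.mem_support_append_iff]; exact .inl q.end_mem_support)
    rw [← h.eq_root_of_inter hpar hy hyj]
    exact hs q.end_mem_support
  · exact (h.exists_parent_path hk hd p ha hb).1

/-- A hammock that is not a root hammock has a parent, which is the root hammock or is closer to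
it. -/
theorem Setup.exists_parent (h : Setup G T r B F) {j k : ι} (hk : k ∈ F.rootHammocks)
    (hjk : j ≠ k) (hc : F.SameComponent G j k) :
    ∃ i, F.IsParent G i j ∧ (i = k ∨ (i ≠ k ∧ F.SameComponent G i k ∧
      (F.union G).dist (F.root i) (F.root k) < (F.union G).dist (F.root j) (F.root k))) := by
  classical
  by_cases hd : (F.verts j ∩ F.verts k).Nonempty
  · obtain ⟨w, hw, hw'⟩ := hd
    exact ⟨k, isParent_of_inter hk hjk hw hw', .inl rfl⟩
  · obtain ⟨a, ha, b, hb, ⟨p⟩⟩ := hc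
    obtain ⟨-, i, z, y, hpar, hadj, hy, q, hq⟩ := h.exists_parent_path hk hd p ha hb
    refine ⟨i, hpar, ?_⟩
    by_cases hik : i = k
    · exact .inl hik
    · refine .inr ⟨hik, ⟨z, hadj.2.2, y, hy, ⟨q⟩⟩, ?_⟩
      have hne : F.root i ≠ F.root j := fun e => by
        have := h.root_mem_support hk hik q hadj.2.2 hy
        exact hq (e ▸ this)
      obtain ⟨R, -, -⟩ := h.exists_path hy (h.root_mem k)
      have hreach : (F.union G).Reachable (F.root j) (F.root k) :=
        (SimpleGraph.Adj.reachable (union_adj.2 ⟨i, hadj⟩)).trans ⟨q.append R⟩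
      -- The vertex $r_j$ lies in $H_i$, so every walk from it to $r_k$ passes $r_i \ne r_j$; on a
      -- shortest one this makes $r_i$ strictly closer to $r_k$.
      obtain ⟨s, hs⟩ := hreach.exists_walk_length_eq_dist
      have hmem := h.root_mem_support hk hik s hadj.2.1 (h.root_mem k)
      have h₁ := congrArg SimpleGraph.Walk.length (s.take_spec hmem)
      rw [SimpleGraph.Walk.length_append] at h₁
      have h₂ := (F.union G).dist_le (s.dropUntil _ hmem)
      have h₃ : (s.takeUntil _ hmem).length ≠ 0 := fun e =>
        hne (SimpleGraph.Walk.eq_of_length_eq_zero e).symm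
      omega

/-- A vertex lies in at most one hammock of which it is not the root. -/
theorem Setup.eq_of_mem (h : Setup G T r B F) {i j : ι} {v : V} (hi : v ∈ F.verts i)
    (hj : v ∈ F.verts j) (hvi : v ≠ F.root i) (hvj : v ≠ F.root j) : i = j := by
  classical
  obtain ⟨k, ⟨hk, hc⟩, -⟩ := h.dec.forest.exists_root i
  by_contra hij
  by_cases hik : i = k
  · subst hik
    exact hvj (h.eq_root_of_inter (isParent_of_inter hk (Ne.symm hij) hj hi) hi hj)
  by_cases hjk : j = k
  · subst hjk
    exact hvi (h.eq_root_of_inter (isParent_of_inter hk hij hi hj) hj hi)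
  obtain ⟨a, ha, b, hb, hab⟩ := hc
  have hle : F.graph G i ≤ F.union G := le_iSup (F.graph G) i
  obtain ⟨p, hp, -⟩ := (((h.reachable hi ha).mono hle).trans hab).exists_path_of_dist
  -- One path from `v` to the root hammock passes the roots of both hammocks. By convexity its first
  -- edge lies in both, against edge-disjointness.
  have key : ∀ l, l ≠ k → v ∈ F.verts l → v ≠ F.root l → p.snd ∈ F.verts l := by
    intro l hl hvl hvr
    have hmem := h.root_mem_support hk hl p hvl hb
    have hin := h.convex (hp.takeUntil hmem) hvl (h.root_mem l)
    refine hin _ ?_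
    rw [← p.snd_takeUntil hvr.symm hmem]
    exact SimpleGraph.Walk.getVert_mem_support _ _
  have hnil : ¬ p.Nil := fun hn => by
    have := h.root_mem_support hk hik p hi hb
    rw [SimpleGraph.Walk.nil_iff_support_eq.1 hn, List.mem_singleton] at this
    exact hvi this.symm
  have hadj := union_le (p.adj_snd hnil)
  exact hij (h.eq_of_adj (u := v) (v := p.snd) ⟨hadj, hi, key i hik hi hvi⟩
    ⟨hadj, hj, key j hjk hj hvj⟩)

end Forest

/-! ### Hysteresis sets

For every window `[lo, hi)` of depths we define a set of vertices that contains all deeper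
vertices and no higher ones. Inside the window, membership is inherited along the hammocks from
their roots. -/

/-- `s` is an end in `Tⱼ'` of a cross edge of `Hⱼ`, and `q ∈ Tⱼ'` is a common ancestor of `s`
and `v`. -/
structure IsLink (G : SimpleGraph V) (r : V) (F : HammockFamily V ι) (j : ι) (v q s : V) :
    Prop where
  peak_mem : q ∈ F.tree' j
  end_mem : s ∈ F.tree' j
  anc : Anc G r q v
  anc_end : Anc G r q s
  adj : ∃ t ∈ F.tree j, G.Adj t s

/-- A link that realizes the shortest way from `rⱼ` to `v` inside `Hⱼ`. -/
def IsBestLink (G : SimpleGraph V) (r : V) (F : HammockFamily V ι) (j : ι) (v q s : V) : Prop :=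
  IsLink G r F j v q s ∧ ∀ q' s', IsLink G r F j v q' s' →
    G.dist r s + G.dist r q' ≤ G.dist r s' + G.dist r q

/-- The vertices on the far side of the window `[lo, hi)`. -/
inductive Deep (G : SimpleGraph V) (r : V) (F : HammockFamily V ι) (lo hi : ℝ) : V → Prop
  | of_le {v : V} : hi ≤ G.dist r v → Deep G r F lo hi v
  | tree {j : ι} {v : V} : v ∈ F.tree j → v ≠ F.root j → Deep G r F lo hi (F.root j) →
      Deep G r F lo hi v
  | tree' {j : ι} {v q s : V} : v ∈ F.tree' j → IsBestLink G r F j v q s → lo ≤ G.dist r q →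
      Deep G r F lo hi (F.root j) → Deep G r F lo hi v
  | link {j : ι} {v q s : V} : v ∈ F.tree' j → IsBestLink G r F j v q s → lo ≤ G.dist r q →
      hi ≤ G.dist r s → Deep G r F lo hi v

section Deep

variable {G T : SimpleGraph V} {r : V} {B : Set V} {F : HammockFamily V ι} {lo hi : ℝ}

/-- For a link the way from $r_j$ over the cross edge to `s`, up to `q` and down to `v` has length
$2(d(r,s)-d(r,q))$ plus a constant depending only on `v` and `j`. So optimality means minimizing
$d(r,s)-d(r,q)$. -/
theorem IsLink.exists_best {j : ι} {v q s : V} (hG : UniqueGeod G) (h : IsLink G r F j v q s) :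
    ∃ q s, IsBestLink G r F j v q s := by
  classical
  have hex : ∃ n, ∃ q s, IsLink G r F j v q s ∧ G.dist r s = G.dist r q + n :=
    ⟨_, q, s, h, (Nat.add_sub_cancel' (h.anc_end.dist_le hG)).symm⟩
  obtain ⟨q₀, s₀, h₀, e₀⟩ := Nat.find_spec hex
  refine ⟨q₀, s₀, h₀, fun q' s' h' => ?_⟩
  have hle := h'.anc_end.dist_le hG
  have := Nat.find_min' hex ⟨q', s', h', (Nat.add_sub_cancel' hle).symm⟩
  omega

theorem Setup.root_ne_of_mem_tree' (h : Setup G T r B F) {j : ι} {v : V} (hv : v ∈ F.tree' j) :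
    v ≠ F.root j := by
  rintro rfl
  exact (h.isHam j).disjoint _ (h.isHam j).left.root_mem hv

theorem Deep.le_dist (h : Setup G T r B F) (hlh : lo ≤ hi) {v : V} (hv : Deep G r F lo hi v) :
    lo ≤ G.dist r v := by
  induction hv with
  | of_le h' => exact hlh.trans h'
  | tree h₁ _ _ ih =>
    exact ih.trans (Nat.cast_le.2 (((h.isHam _).left.anc _ h₁).dist_le h.geod))
  | tree' _ h₂ h₃ _ _ => exact h₃.trans (Nat.cast_le.2 (h₂.1.anc.dist_le h.geod))
  | link _ h₂ h₃ _ => exact h₃.trans (Nat.cast_le.2 (h₂.1.anc.dist_le h.geod))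

theorem Setup.deep_tree_iff (h : Setup G T r B F) {j : ι} {v : V} (hv : v ∈ F.tree j) :
    Deep G r F lo hi v ↔ hi ≤ G.dist r v ∨ Deep G r F lo hi (F.root j) := by
  constructor
  · intro hd
    by_cases hne : v = F.root j
    · exact .inr (hne ▸ hd)
    cases hd with
    | of_le h' => exact .inl h'
    | tree h₁ h₂ h₃ =>
      rw [h.eq_of_mem (.inl h₁) (.inl hv) h₂ hne] at h₃
      exact .inr h₃
    | tree' h₁ _ _ _ | link h₁ _ _ _ =>
      have e := h.eq_of_mem (.inr h₁) (.inl hv) (h.root_ne_of_mem_tree' h₁) hne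
      exact ((h.isHam j).disjoint _ hv (e ▸ h₁)).elim
  · rintro (h' | h')
    · exact .of_le h'
    · by_cases hne : v = F.root j
      · exact hne ▸ h'
      · exact .tree hv hne h'

/-- A vertex is a non-root member of at most one hammock, so only the rules for this hammock can
apply. The criterion is the final state of the traveller: on at `s` by inheritance or by depth,
still on at the peak `q`, or switched on at `v` itself. -/
theorem Setup.deep_tree'_iff (h : Setup G T r B F) {j : ι} {v : V} (hv : v ∈ F.tree' j) :
    Deep G r F lo hi v ↔ hi ≤ G.dist r v ∨ ∃ q s, IsBestLink G r F j v q s ∧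
      lo ≤ G.dist r q ∧ (Deep G r F lo hi (F.root j) ∨ hi ≤ G.dist r s) := by
  have hne := h.root_ne_of_mem_tree' hv
  constructor
  · intro hd
    cases hd with
    | of_le h' => exact .inl h'
    | tree h₁ h₂ _ =>
      have e := h.eq_of_mem (.inl h₁) (.inr hv) h₂ hne
      exact ((h.isHam j).disjoint _ (e ▸ h₁) hv).elim
    | tree' h₁ h₂ h₃ h₄ =>
      obtain rfl := h.eq_of_mem (.inr h₁) (.inr hv) (h.root_ne_of_mem_tree' h₁) hne
      exact .inr ⟨_, _, h₂, h₃, .inl h₄⟩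
    | link h₁ h₂ h₃ h₄ =>
      obtain rfl := h.eq_of_mem (.inr h₁) (.inr hv) (h.root_ne_of_mem_tree' h₁) hne
      exact .inr ⟨_, _, h₂, h₃, .inr h₄⟩
  · rintro (h' | ⟨q, s, h₁, h₂, h₃ | h₃⟩)
    · exact .of_le h'
    · exact .tree' hv h₁ h₂ h₃
    · exact .link hv h₁ h₂ h₃

theorem Deep.of_le_par (h : Setup G T r B F) {v : V} (hp : hi ≤ G.dist r (par G r v)) :
    Deep G r F lo hi v :=
  .of_le (hp.trans (Nat.cast_le.2 ((anc_par G r v).dist_le h.geod)))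

/-- A best link of the parent is a link of `v`. If it is no longer best, the better one must have
its peak at `v` itself, as otherwise it would already have served the parent; its cross edge is then
at least as deep as the old one, so the criterion persists. -/
theorem Setup.deep_of_par_tree' (h : Setup G T r B F) (hlh : lo ≤ hi) {j : ι} {v : V}
    (hv : v ∈ F.tree' j) (hpv : par G r v ∈ F.tree' j) (hd : Deep G r F lo hi (par G r v)) :
    Deep G r F lo hi v := by
  have hlo : lo ≤ G.dist r v :=
    (hd.le_dist h hlh).trans (Nat.cast_le.2 ((anc_par G r v).dist_le h.geod))
  rcases (h.deep_tree'_iff hpv).1 hd with h' | ⟨q, s, hb, hq, hc⟩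
  · exact .of_le_par h h'
  · refine (h.deep_tree'_iff hv).2 (.inr ?_)
    have hl : IsLink G r F j v q s :=
      ⟨hb.1.peak_mem, hb.1.end_mem, hb.1.anc.trans (anc_par G r v), hb.1.anc_end, hb.1.adj⟩
    obtain ⟨q₁, s₁, hb₁⟩ := hl.exists_best h.geod
    by_cases hbest : IsBestLink G r F j v q s
    · exact ⟨q, s, hbest, hq, hc⟩
    have hlt : G.dist r s₁ + G.dist r q < G.dist r s + G.dist r q₁ := by
      by_contra hle
      refine hbest ⟨hl, fun q' s' h' => ?_⟩
      have := hb₁.2 q' s' h'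
      omega
    rcases hb₁.1.anc.eq_or_anc_par with rfl | ha
    · refine ⟨q₁, s₁, hb₁, hlo, hc.imp_right fun hs => hs.trans (Nat.cast_le.2 ?_)⟩
      have := hb.2 q s₁ ⟨hb.1.peak_mem, hb₁.1.end_mem, hb.1.anc,
        (hb.1.anc.trans (anc_par G r _)).trans hb₁.1.anc_end, hb₁.1.adj⟩
      omega
    · have := hb.2 q₁ s₁ ⟨hb₁.1.peak_mem, hb₁.1.end_mem, ha, hb₁.1.anc_end, hb₁.1.adj⟩
      omega

/-- Inside a hammock, `Deep` is inherited by children. -/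
theorem Setup.deep_of_anc_tree (h : Setup G T r B F) {j : ι} {u v : V} (hu : u ∈ F.tree j)
    (hv : v ∈ F.tree j) (huv : Anc G r u v) (hd : Deep G r F lo hi u) : Deep G r F lo hi v := by
  rw [h.deep_tree_iff hu] at hd
  exact (h.deep_tree_iff hv).2 (hd.imp_left fun h' =>
    h'.trans (Nat.cast_le.2 (huv.dist_le h.geod)))

theorem Setup.deep_of_anc_tree' (h : Setup G T r B F) (hlh : lo ≤ hi) {j : ι} {u v : V}
    (hu : u ∈ F.tree' j) (hv : v ∈ F.tree' j) (huv : Anc G r u v) (hd : Deep G r F lo hi u) :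
    Deep G r F lo hi v := by
  induction hn : G.dist r v using Nat.strong_induction_on generalizing v with
  | _ n ih =>
    rcases huv.eq_or_anc_par with rfl | ha
    · exact hd
    have hvr : v ≠ r := (h.isHam j).symm.ne_root_left h.geod hv
    have hpv := (par_spec h.geod hvr).2
    have hmem : par G r v ∈ F.tree' j := (h.isHam j).right.mem_of_anc h.geod hv (anc_par G r v)
      (((h.isHam j).right.anc u hu).trans ha)
    exact h.deep_of_par_tree' hlh hv hmem (ih _ (by omega) hmem ha rfl)

/-- Vertices of the base tree lie in hammocks only as their roots. -/
theorem Setup.eq_root_of_mem_base (h : Setup G T r B F) {j : ι} {v : V} (hB : v ∈ B)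
    (hv : v ∈ F.verts j) : v = F.root j := by
  by_contra hne
  have hvr : v ≠ r := by
    rcases hv with hv | hv
    · exact (h.isHam j).ne_root_left h.geod hv
    · exact (h.isHam j).symm.ne_root_left h.geod hv
  have hadj := h.tree.adj_par h.geod hvr
  have hpB : par G r v ∈ B :=
    h.tree.par_mem h.geod h.dec.base_connected h.dec.root_mem (anc_root h.geod v) hB hvr
  have hbase : s(par G r v, v) ∈ baseEdges T B := by
    refine ⟨hadj, fun w hw => ?_⟩
    rcases Sym2.mem_iff.1 hw with rfl | rfl <;> assumption
  have hout : par G r v ∉ F.verts j := fun hp =>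
    Set.disjoint_left.1 h.dec.disjoint₁ hbase
      (Set.mem_iUnion.2 ⟨j, show (F.graph G j).Adj _ _ from ⟨h.tree.le hadj, hp, hv⟩⟩)
  rcases hv with hv | hv
  · exact hout (.inl ((h.isHam j).left.par_mem v hv hne))
  · by_cases e : v = F.root' j
    · refine Set.disjoint_left.1 h.dec.disjoint₂ hbase ⟨j, par G r v, ?_, by rw [e]⟩
      rw [← e]
      exact ⟨hadj, (h.tree.ancEq_iff h.geod).2 (anc_par G r v)⟩
    · exact hout (.inr ((h.isHam j).right.par_mem v hv e))

/-- On the base tree no state is inherited, since its vertices occur in hammocks only as the roots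
$r_j$: the boundary there is the sharp depth $hi$. -/
theorem Setup.deep_base (h : Setup G T r B F) {v : V} (hB : v ∈ B) (hd : Deep G r F lo hi v) :
    hi ≤ G.dist r v := by
  cases hd with
  | of_le h' => exact h'
  | tree h₁ h₂ _ => exact absurd (h.eq_root_of_mem_base hB (.inl h₁)) h₂
  | tree' h₁ _ _ _ | link h₁ _ _ _ =>
    exact absurd (h.eq_root_of_mem_base hB (.inr h₁)) (h.root_ne_of_mem_tree' h₁)

/-- Every link of the highest vertex of $T_j'$ has its peak there, so the state of $r_j$ is passed
on unless the depth is below $lo$. -/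
theorem Setup.deep_root' (h : Setup G T r B F) {j : ι} (hlo : lo ≤ G.dist r (F.root' j))
    (hd : Deep G r F lo hi (F.root j)) : Deep G r F lo hi (F.root' j) := by
  have hj := h.isHam j
  obtain ⟨t, ht, s, hs, hts⟩ := hj.cross
  obtain ⟨q, s, hb⟩ := IsLink.exists_best h.geod (F := F) (j := j) (v := F.root' j)
    ⟨hj.right.root_mem, hs, Anc.refl _ _ _, hj.right.anc s hs, t, ht, hts⟩
  have hq : q = F.root' j := hb.1.anc.antisymm h.geod (hj.right.anc q hb.1.peak_mem)
  exact .tree' hj.right.root_mem hb (hq ▸ hlo) hd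

/-- If the least common ancestor of the hammock roots is `Deep`, so are the roots. -/
theorem Setup.deep_roots_of_lca (h : Setup G T r B F) (hlh : lo ≤ hi) {j k : ι}
    (hk : k ∈ F.rootHammocks) (hc : F.SameComponent G j k) {l : V}
    (hl : IsLca T r l (F.root j) (F.root' j)) (hd : Deep G r F lo hi l) :
    Deep G r F lo hi (F.root j) ∧ Deep G r F lo hi (F.root' j) := by
  -- The lca of a hammock lies in its parent hammock or is also the lca of the parent, so the
  -- induction runs along parents towards the root hammock, whose lca is in the base tree.
  induction hn : (F.union G).dist (F.root j) (F.root k) using Nat.strong_induction_on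
    generalizing j with
  | _ n ih =>
  have hlca : ∀ {l l' u v}, IsLca T r l u v → IsLca T r l' u v → l = l' := fun h₁ h₂ =>
    ((h.tree.ancEq_iff h.geod).1 (h₂.2.2 _ h₁.1 h₁.2.1)).antisymm h.geod
      ((h.tree.ancEq_iff h.geod).1 (h₁.2.2 _ h₂.1 h₂.2.1))
  have ha : Anc G r l (F.root j) := (h.tree.ancEq_iff h.geod).1 hl.1
  have ha' : Anc G r l (F.root' j) := (h.tree.ancEq_iff h.geod).1 hl.2.1
  have hbase : ∀ m ∈ B, m = l →
      Deep G r F lo hi (F.root j) ∧ Deep G r F lo hi (F.root' j) := by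
    rintro m hm rfl
    have := h.deep_base hm hd
    exact ⟨.of_le (this.trans (Nat.cast_le.2 (ha.dist_le h.geod))),
      .of_le (this.trans (Nat.cast_le.2 (ha'.dist_le h.geod)))⟩
  by_cases hjk : j = k
  · subst hjk
    obtain ⟨l', hl', -, -, hB⟩ := h.dec.lcaRespecting.base_lca j hk
    exact hbase l' hB (hlca hl' hl)
  obtain ⟨i, hpar, hi'⟩ := h.exists_parent hk hjk hc
  have hri : F.root j ∈ F.verts i := by
    have : F.root j ∈ F.verts i ∩ F.verts j := by
      rw [h.dec.lcaRespecting.inter_eq i j hpar]; rfl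
    exact this.1
  obtain ⟨l', hl', -, hl''⟩ := h.dec.lcaRespecting.lca i j hpar
  obtain rfl := hlca hl' hl
  suffices hr : Deep G r F lo hi (F.root j) from
    ⟨hr, h.deep_root' ((hd.le_dist h hlh).trans (Nat.cast_le.2 (ha'.dist_le h.geod))) hr⟩
  -- If the lca is in $H_i$, it is on the same side as its descendant $r_j$ and inheritance inside
  -- that side suffices. Otherwise induction makes both roots of $H_i$ deep, and $r_j$ lies below
  -- one of them.
  rcases hl'' with hmem | hli
  · rcases hmem with hmem | hmem <;> rcases hri with hri | hri
    · exact h.deep_of_anc_tree hmem hri ha hd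
    · exact absurd ha ((h.isHam i).not_anc_of_mem h.geod hmem hri)
    · exact absurd ha ((h.isHam i).symm.not_anc_of_mem h.geod hmem hri)
    · exact h.deep_of_anc_tree' hlh hmem hri ha hd
  · rcases hi' with rfl | ⟨-, hci, hlt⟩
    · obtain ⟨m, hm, -, -, hB⟩ := h.dec.lcaRespecting.base_lca i hk
      exact (hbase m hB (hlca hm hli)).1
    · obtain ⟨h₁, h₂⟩ := ih _ (by omega) hci hli rfl
      rcases hri with hri | hri
      · exact h.deep_of_anc_tree (h.isHam i).left.root_mem hri ((h.isHam i).left.anc _ hri) h₁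
      · exact h.deep_of_anc_tree' hlh (h.isHam i).right.root_mem hri
          ((h.isHam i).right.anc _ hri) h₂

/-- `Deep` is inherited by children in the BFS tree. -/
theorem Setup.deep_of_par (h : Setup G T r B F) (hlh : lo ≤ hi) {v : V}
    (hd : Deep G r F lo hi (par G r v)) : Deep G r F lo hi v := by
  by_cases hvr : v = r
  · subst hvr; rwa [par_root] at hd
  have hadj := h.tree.adj_par h.geod hvr
  have he : s(par G r v, v) ∈ G.edgeSet := h.tree.le hadj
  rw [h.dec.edges_eq] at he
  rcases he with (he | he) | ⟨j, p, hp, he⟩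
  · exact .of_le_par h (h.deep_base (he.2 _ (Sym2.mem_mk_left _ _)) hd)
  · obtain ⟨j, hj⟩ := Set.mem_iUnion.1 he
    have hj' : (F.graph G j).Adj (par G r v) v := hj
    rcases hj'.2 with ⟨h₁ | h₁, h₂ | h₂⟩
    · exact h.deep_of_anc_tree h₁ h₂ (anc_par G r v) hd
    · exact absurd (anc_par G r v) ((h.isHam j).not_anc_of_mem h.geod h₁ h₂)
    · exact absurd (anc_par G r v) ((h.isHam j).symm.not_anc_of_mem h.geod h₁ h₂)
    · exact h.deep_of_par_tree' hlh h₂ h₁ hd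
  -- The remaining tree edges are those above some $r_j'$; there the parent is the lca of the two
  -- hammock roots.
  · have hv : v = F.root' j ∧ par G r v = p := by
      rcases Sym2.eq_iff.1 he with ⟨h₁, h₂⟩ | ⟨h₁, h₂⟩
      · exact ⟨h₂, h₁⟩
      · have e := (h.tree.isTreeParent h.geod hp).1
        rw [← h₂, ← h₁] at e
        exact absurd (Anc.antisymm h.geod (anc_par G r v)
          ⟨1, by simpa using e.symm⟩) hadj.ne
    obtain ⟨k, ⟨hk, hc⟩, -⟩ := h.dec.forest.exists_root j
    obtain ⟨l, hl, hlp⟩ : ∃ l, IsLca T r l (F.root j) (F.root' j) ∧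
        IsTreeParent T r l (F.root' j) := by
      by_cases hjk : j = k
      · subst hjk
        obtain ⟨l, h₁, -, h₂, -⟩ := h.dec.lcaRespecting.base_lca j hk
        exact ⟨l, h₁, h₂⟩
      · obtain ⟨i, hpar, -⟩ := h.exists_parent hk hjk hc
        obtain ⟨l, h₁, h₂, -⟩ := h.dec.lcaRespecting.lca i j hpar
        exact ⟨l, h₁, h₂⟩
    have e := (h.tree.isTreeParent h.geod hlp).1
    rw [← hv.1] at e
    rw [hv.1]
    exact (h.deep_roots_of_lca hlh hk hc hl (e ▸ hd)).2

end Deep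

/-! ### Counting changes along a sequence -/

open Classical in
/-- The number of indices `i ∈ [a, b)` at which `σ` changes between `i` and `i + 1`. -/
noncomputable def cuts (σ : ℕ → Prop) (a b : ℕ) : ℕ :=
  ((Finset.Ico a b).filter fun i => ¬ (σ i ↔ σ (i + 1))).card

section Cuts

variable {σ : ℕ → Prop} {a b c : ℕ}

theorem cuts_le_add (σ : ℕ → Prop) (a b c : ℕ) : cuts σ a b ≤ cuts σ a c + cuts σ c b := by
  classical
  rw [cuts, cuts, cuts]
  refine (Finset.card_le_card fun i hi => ?_).trans (Finset.card_union_le _ _)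
  simp only [Finset.mem_union, Finset.mem_filter, Finset.mem_Ico] at hi ⊢
  rcases lt_or_ge i c with h | h
  · exact .inl ⟨⟨hi.1.1, h⟩, hi.2⟩
  · exact .inr ⟨⟨h, hi.1.2⟩, hi.2⟩

theorem cuts_le_sub (σ : ℕ → Prop) (a b : ℕ) : cuts σ a b ≤ b - a := by
  classical
  rw [cuts]
  exact (Finset.card_filter_le _ _).trans (by simp)

theorem cuts_le_one_of_imp (h : ∀ i, a ≤ i → i < b → σ i → σ (i + 1)) : cuts σ a b ≤ 1 := by
  classical
  have key : ∀ i j, a ≤ i → i ≤ j → j ≤ b → σ i → σ j := by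
    intro i j hi hij hj
    induction j, hij using Nat.le_induction with
    | base => exact id
    | succ j hij ih => exact fun hσ => h j (by omega) (by omega) (ih (by omega) hσ)
  have hlt : ∀ i j, a ≤ i → i < j → j < b → ¬ (σ i ↔ σ (i + 1)) → (σ j ↔ σ (j + 1)) := by
    intro i j hi hij hj hne
    have h₁ : σ (i + 1) := by
      by_contra hn
      exact hne ⟨fun hσ => h i hi (by omega) hσ, fun hσ => absurd hσ hn⟩
    exact ⟨h j (by omega) hj, fun _ => key (i + 1) j (by omega) hij (by omega) h₁⟩
  rw [cuts, Finset.card_le_one]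
  intro i hi j hj
  simp only [Finset.mem_filter, Finset.mem_Ico] at hi hj
  rcases Nat.lt_trichotomy i j with hij | hij | hij
  · exact absurd (hlt i j hi.1.1 hij hj.1.2 hi.2) hj.2
  · exact hij
  · exact absurd (hlt j i hj.1.1 hij hi.1.2 hj.2) hi.2

theorem cuts_not (σ : ℕ → Prop) (a b : ℕ) : cuts (fun i => ¬ σ i) a b = cuts σ a b := by
  rw [cuts, cuts]
  congr 1
  ext i
  simp only [Finset.mem_filter, not_iff_not]

theorem cuts_reverse (σ : ℕ → Prop) (h : a ≤ b) :
    cuts σ a b = cuts (fun t => σ (b - t)) 0 (b - a) := by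
  classical
  rw [cuts, cuts]
  refine Finset.card_bij (fun i _ => b - 1 - i) ?_ ?_ ?_
  · intro i hi
    simp only [Finset.mem_filter, Finset.mem_Ico] at hi ⊢
    rw [show b - (b - 1 - i) = i + 1 by omega, show b - (b - 1 - i + 1) = i by omega]
    exact ⟨by omega, fun e => hi.2 e.symm⟩
  · intro i hi j hj e
    simp only [Finset.mem_filter, Finset.mem_Ico] at hi hj
    omega
  · intro i hi
    simp only [Finset.mem_filter, Finset.mem_Ico] at hi
    refine ⟨b - 1 - i, ?_, by omega⟩
    simp only [Finset.mem_filter, Finset.mem_Ico]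
    rw [show b - 1 - i = b - (i + 1) by omega, show b - (i + 1) + 1 = b - i by omega]
    exact ⟨by omega, fun e => hi.2 e.symm⟩

/-- A sequence that changes to true only at depth at least `hi` and to false only at depth less
than `lo` changes rarely. -/
theorem cuts_le_two_of_hysteresis {D : ℕ → ℝ} {lo hi : ℝ}
    (hD : ∀ i j, a ≤ i → i ≤ j → j ≤ b → |D i - D j| ≤ (j : ℝ) - i)
    (hin : ∀ i, a ≤ i → i < b → ¬ σ i → σ (i + 1) → hi ≤ D (i + 1))
    (hout : ∀ i, a ≤ i → i < b → σ i → ¬ σ (i + 1) → D (i + 1) < lo)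
    (hlh : lo < hi) (hab : (b : ℝ) - a ≤ 2 * (hi - lo)) : cuts σ a b ≤ 2 := by
  classical
  -- Here `i` is the last change before `c`; each change after the first costs at least `hi - lo`
  -- steps.
  have key : ∀ c, a ≤ c → c ≤ b → cuts σ a c ≠ 0 → ∃ i, a ≤ i ∧ i < c ∧ ¬ (σ i ↔ σ (i + 1)) ∧
      (σ (i + 1) ↔ σ c) ∧ ((cuts σ a c : ℝ) - 1) * (hi - lo) ≤ (i : ℝ) - a := by
    intro c hac
    induction c, hac using Nat.le_induction with
    | base => intro _ h; exact absurd (Nat.le_zero.1 ((cuts_le_sub σ a a).trans (by simp))) h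
    | succ c hac ih =>
      intro hcb h
      have hs : cuts σ a (c + 1) = cuts σ a c + if σ c ↔ σ (c + 1) then 0 else 1 := by
        rw [cuts, cuts, Nat.Ico_succ_right_eq_insert_Ico hac, Finset.filter_insert]
        by_cases hc : σ c ↔ σ (c + 1)
        · rw [if_neg (not_not.2 hc), if_pos hc, add_zero]
        · rw [if_pos hc, if_neg hc, Finset.card_insert_of_notMem (by simp)]
      by_cases hc : σ c ↔ σ (c + 1)
      · rw [if_pos hc, add_zero] at hs
        rw [hs] at h ⊢
        obtain ⟨i, h₁, h₂, h₃, h₄, h₅⟩ := ih (by omega) h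
        exact ⟨i, h₁, by omega, h₃, h₄.trans hc, h₅⟩
      · rw [if_neg hc] at hs
        refine ⟨c, hac, by omega, hc, Iff.rfl, ?_⟩
        rw [hs]
        push_cast
        by_cases h₀ : cuts σ a c = 0
        · rw [h₀]
          have : (a : ℝ) ≤ c := Nat.cast_le.2 hac
          simp only [Nat.cast_zero]
          linarith
        · obtain ⟨i, h₁, h₂, h₃, h₄, h₅⟩ := ih (by omega) h₀
          have hd := abs_le.1 (hD (i + 1) (c + 1) (by omega) (by omega) hcb)
          push_cast at hd
          -- Consecutive changes go in opposite directions, so one ends at depth at least `hi` and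
          -- the other below `lo`, while depth moves by at most one per step.
          have : hi - lo ≤ (c : ℝ) - i := by
            by_cases hσ : σ c
            · have e₁ := hin i h₁ (by omega)
                (fun hi => h₃ ⟨fun _ => h₄.2 hσ, fun _ => hi⟩) (h₄.2 hσ)
              have e₂ := hout c hac (by omega) hσ (fun h => hc ⟨fun _ => h, fun _ => hσ⟩)
              linarith [hd.2]
            · have hσ' : ¬ σ (i + 1) := fun h => hσ (h₄.1 h)
              have e₁ := hout i h₁ (by omega)
                (by by_contra hn; exact h₃ ⟨fun h => absurd h hn, fun h => absurd h hσ'⟩) hσ'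
              have e₂ := hin c hac (by omega) hσ
                (by by_contra hn; exact hc ⟨fun h => absurd h hσ, fun h => absurd h hn⟩)
              linarith [hd.1]
          linarith
  by_contra hgt
  push Not at hgt
  have hab' : a ≤ b := by
    by_contra hn
    have := cuts_le_sub σ a b
    omega
  obtain ⟨i, -, h₂, -, -, h₅⟩ := key b hab' le_rfl (by omega)
  have h₃ : (3 : ℝ) ≤ cuts σ a b := by exact_mod_cast hgt
  have h₄ : (i : ℝ) < b := Nat.cast_lt.2 h₂
  have h₆ : 2 * (hi - lo) ≤ ((cuts σ a b : ℝ) - 1) * (hi - lo) :=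
    mul_le_mul_of_nonneg_right (by linarith) (by linarith)
  linarith

end Cuts

/-! ### Runs of tree edges on a geodesic -/

section Runs

variable {G T : SimpleGraph V} {r : V} {B : Set V} {F : HammockFamily V ι} {f : ℕ → V} {a b m : ℕ}

/-- `f` climbs in the tree on `[a, b]`. -/
def Climbs (G : SimpleGraph V) (r : V) (f : ℕ → V) (a b : ℕ) : Prop :=
  ∀ i, a ≤ i → i < b → f (i + 1) = par G r (f i) ∧ G.dist r (f i) = G.dist r (f (i + 1)) + 1

/-- `f` descends in the tree on `[a, b]`. -/
def Descends (G : SimpleGraph V) (r : V) (f : ℕ → V) (a b : ℕ) : Prop :=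
  ∀ i, a ≤ i → i < b → f i = par G r (f (i + 1)) ∧ G.dist r (f (i + 1)) = G.dist r (f i) + 1

theorem Climbs.anc (h : Climbs G r f a b) (hab : a ≤ b) :
    Anc G r (f b) (f a) ∧ G.dist r (f a) = G.dist r (f b) + (b - a) := by
  induction b, hab using Nat.le_induction with
  | base => exact ⟨Anc.refl _ _ _, by simp⟩
  | succ b hab ih =>
    obtain ⟨h₁, h₂⟩ := ih fun i hi hib => h i hi (by omega)
    obtain ⟨h₃, h₄⟩ := h b hab (by omega)
    exact ⟨(h₃ ▸ anc_par G r _ : Anc G r (f (b + 1)) (f b)).trans h₁, by omega⟩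

theorem Descends.anc (h : Descends G r f a b) (hab : a ≤ b) :
    Anc G r (f a) (f b) ∧ G.dist r (f b) = G.dist r (f a) + (b - a) := by
  induction b, hab using Nat.le_induction with
  | base => exact ⟨Anc.refl _ _ _, by simp⟩
  | succ b hab ih =>
    obtain ⟨h₁, h₂⟩ := ih fun i hi hib => h i hi (by omega)
    obtain ⟨h₃, h₄⟩ := h b hab (by omega)
    exact ⟨h₁.trans (h₃ ▸ anc_par G r _ : Anc G r (f b) (f (b + 1))), by omega⟩

/-- A geodesic without cross edges climbs and then descends. -/
theorem Geod.exists_peak (hG : UniqueGeod G) (hf : Geod G f a b) (hab : a ≤ b)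
    (h : ∀ i, a ≤ i → i < b → G.dist r (f i) ≠ G.dist r (f (i + 1))) :
    ∃ m, a ≤ m ∧ m ≤ b ∧ Climbs G r f a m ∧ Descends G r f m b := by
  induction b, hab using Nat.le_induction with
  | base => exact ⟨a, le_rfl, le_rfl, fun i _ _ => by omega, fun i _ _ => by omega⟩
  | succ b hab ih =>
    obtain ⟨m, h₁, h₂, h₃, h₄⟩ := ih (hf.mono le_rfl (by omega)) fun i hi hib => h i hi (by omega)
    rcases adj_cases hG r (hf.adj hab (Nat.lt_succ_self b)) with h' | h' | h'
    · refine ⟨m, h₁, by omega, h₃, fun i hi hib => ?_⟩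
      rcases Nat.lt_succ_iff_lt_or_eq.1 hib with hib | rfl
      · exact h₄ i hi hib
      · exact h'
    · rcases eq_or_lt_of_le h₂ with rfl | hlt
      · refine ⟨m + 1, by omega, le_rfl, fun i hi hib => ?_, fun i _ _ => by omega⟩
        rcases Nat.lt_succ_iff_lt_or_eq.1 hib with hib | rfl
        · exact h₃ i hi hib
        · exact h'
      -- Climbing right after descending would return to the same parent and repeat a vertex.
      · obtain ⟨c, rfl⟩ : ∃ c, b = c + 1 := ⟨b - 1, by omega⟩
        have e := (h₄ c (by omega) (by omega)).1
        rw [← h'.1] at e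
        have := hf.inj (by omega) (by omega) (by omega) (by omega) e
        omega
    · exact absurd h' (h b hab (by omega))

open Classical in
/-- The number of cross edges of `f` on `[a, b]`. -/
noncomputable def crossCount (G : SimpleGraph V) (r : V) (f : ℕ → V) (a b : ℕ) : ℕ :=
  ((Finset.Ico a b).filter fun i => G.dist r (f i) = G.dist r (f (i + 1))).card

theorem crossCount_add_le {c : ℕ} (ha : a ≤ c) (hb : c < b)
    (hc : G.dist r (f c) = G.dist r (f (c + 1))) :
    crossCount G r f a c + crossCount G r f (c + 1) b + 1 ≤ crossCount G r f a b := by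
  classical
  rw [crossCount, crossCount, crossCount]
  rw [← Finset.card_union_of_disjoint, ← Finset.card_insert_of_notMem (a := c)]
  · refine Finset.card_le_card fun i hi => ?_
    simp only [Finset.mem_insert, Finset.mem_union, Finset.mem_filter, Finset.mem_Ico] at hi ⊢
    rcases hi with rfl | ⟨h₁, h₂⟩ | ⟨h₁, h₂⟩
    · exact ⟨by omega, hc⟩
    · exact ⟨by omega, h₂⟩
    · exact ⟨by omega, h₂⟩
  · simp
  · rw [Finset.disjoint_left]
    intro i hi hi'
    simp only [Finset.mem_filter, Finset.mem_Ico] at hi hi'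
    omega

variable {lo hi : ℝ}

/-- Descending preserves `Deep` and climbing preserves its negation, so each of the two runs changes
at most once. -/
theorem Setup.cuts_le_two (h : Setup G T r B F) (hlh : lo ≤ hi) (hf : Geod G f a b) (hab : a ≤ b)
    (hc : ∀ i, a ≤ i → i < b → G.dist r (f i) ≠ G.dist r (f (i + 1))) :
    cuts (fun i => Deep G r F lo hi (f i)) a b ≤ 2 := by
  obtain ⟨m, -, -, h₃, h₄⟩ := hf.exists_peak h.geod hab hc
  refine (cuts_le_add _ a b m).trans (Nat.add_le_add (b := 1) (d := 1) ?_ ?_)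
  · rw [← cuts_not]
    refine cuts_le_one_of_imp fun i hi hib hn hd => hn ?_
    rw [(h₃ i hi hib).1] at hd
    exact h.deep_of_par hlh hd
  · refine cuts_le_one_of_imp fun i hi hib hd => ?_
    rw [(h₄ i hi hib).1] at hd
    exact h.deep_of_par hlh hd

/-- With $k$ cross edges there are $k+1$ runs with at most 2 cuts each, and at most $k$ further cuts
at the cross edges themselves. -/
theorem Setup.cuts_le_crossCount (h : Setup G T r B F) (hlh : lo ≤ hi) (hf : Geod G f a b)
    (hab : a ≤ b) :
    cuts (fun i => Deep G r F lo hi (f i)) a b ≤ 3 * crossCount G r f a b + 2 := by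
  induction hn : b - a using Nat.strong_induction_on generalizing a b with
  | _ n ih =>
    by_cases hc : ∀ i, a ≤ i → i < b → G.dist r (f i) ≠ G.dist r (f (i + 1))
    · exact (h.cuts_le_two hlh hf hab hc).trans (by omega)
    · push Not at hc
      obtain ⟨c, hac, hcb, hc⟩ := hc
      have h₁ := ih _ (by omega) (hf.mono le_rfl hcb.le) hac rfl
      have h₂ := ih _ (by omega) (hf.mono (a' := c + 1) (by omega) le_rfl) hcb rfl
      have h₃ := cuts_le_add (fun i => Deep G r F lo hi (f i)) a b c
      have h₄ := cuts_le_add (fun i => Deep G r F lo hi (f i)) c b (c + 1)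
      have h₅ := cuts_le_sub (fun i => Deep G r F lo hi (f i)) c (c + 1)
      have h₆ := crossCount_add_le hac hcb hc
      omega

/-! ### Hysteresis along geodesics from a hammock root -/

/-- The geodesic itself realizes a best link, with cross edge into `g (t₀ + 1)` and peak `g m`. Any
other best link would give an equally short way, so uniqueness of shortest paths leaves only this
one and the state can be read along `g`. -/
theorem Setup.deep_iff_of_geod (h : Setup G T r B F) {j : ι} {g : ℕ → V} {n t₀ : ℕ}
    (hg : Geod G g 0 n) (h0 : g 0 = F.root j) (ht : t₀ < m) (hm : m ≤ n)
    (h₁ : ∀ t, t ≤ t₀ → g t ∈ F.tree j) (h₂ : ∀ t, t₀ < t → t ≤ n → g t ∈ F.tree' j)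
    (hup : Climbs G r g (t₀ + 1) m) (hdown : Descends G r g m n) :
    Deep G r F lo hi (g n) ↔ hi ≤ G.dist r (g n) ∨
      (lo ≤ G.dist r (g m) ∧ (Deep G r F lo hi (F.root j) ∨ hi ≤ G.dist r (g (t₀ + 1)))) := by
  have hj := h.isHam j
  have hG := h.geod
  obtain ⟨ha₁, hd₁⟩ := hup.anc (by omega)
  obtain ⟨ha₂, hd₂⟩ := hdown.anc hm
  have hs := h₂ (t₀ + 1) (by omega) (by omega)
  have hadj := hg.adj (Nat.zero_le t₀) (by omega)
  have hts := hj.dist_eq hG (h₁ t₀ le_rfl) hs hadj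
  have hd₀ := (hg.mono le_rfl (by omega : t₀ ≤ n)).anc_of_anc hG (r := r)
    (h0 ▸ hj.left.anc _ (h₁ t₀ le_rfl)) le_rfl (Nat.zero_le t₀) le_rfl |>.2
  have hlink : IsLink G r F j (g n) (g m) (g (t₀ + 1)) :=
    ⟨h₂ m ht hm, hs, ha₂, ha₁, g t₀, h₁ t₀ le_rfl, hadj⟩
  have hdist : ∀ q s t, IsLink G r F j (g n) q s → t ∈ F.tree j → G.Adj t s →
      G.dist r s = G.dist r t ∧ G.dist r (g 0) + G.dist (g 0) t = G.dist r t ∧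
      G.dist (g 0) s ≤ G.dist (g 0) t + 1 ∧
      G.dist s (g n) + G.dist r q + G.dist r q ≤ G.dist r s + G.dist r (g n) ∧
      G.dist t (g n) ≤ G.dist s (g n) + 1 ∧ G.dist r q ≤ G.dist r s := by
    intro q s t hl ht hts
    have e₁ := hj.dist_eq hG ht hl.end_mem hts
    have e₂ := (hj.left.anc t ht).dist_eq hG
    have e₃ := hl.anc.dist_eq hG
    have e₄ := hl.anc_end.dist_eq hG
    have e₅ := hG.conn.dist_triangle (u := s) (v := q) (w := g n)
    have e₆ := hG.conn.dist_triangle (u := t) (v := s) (w := g n)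
    have e₇ := hG.conn.dist_triangle (u := g 0) (v := t) (w := s)
    rw [SimpleGraph.dist_eq_one_iff_adj.2 hts] at e₆ e₇
    rw [SimpleGraph.dist_comm (u := q) (v := s)] at e₄
    rw [← h0] at e₂
    refine ⟨e₁.symm, e₂, e₇, by omega, by omega, by omega⟩
  have hn := hg 0 n le_rfl (Nat.zero_le n) le_rfl
  have hbest : IsBestLink G r F j (g n) (g m) (g (t₀ + 1)) := by
    refine ⟨hlink, fun q s hl => ?_⟩
    obtain ⟨t, ht, hts'⟩ := hl.adj
    obtain ⟨e₁, e₂, e₃, e₄, e₅, e₆⟩ := hdist q s t hl ht hts'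
    have e₇ := hG.conn.dist_triangle (u := g 0) (v := t) (w := g n)
    omega
  -- The ends `t` and `s` of a competing cross edge lie on `g`; since `g` changes sides only once,
  -- they are `g t₀` and `g (t₀ + 1)`. The peaks are ancestors of `g n` of equal depth, hence equal.
  have huniq : ∀ q s, IsBestLink G r F j (g n) q s → q = g m ∧ s = g (t₀ + 1) := by
    intro q s hb
    obtain ⟨t, ht, hts'⟩ := hb.1.adj
    obtain ⟨e₁, e₂, e₃, e₄, e₅, e₆⟩ := hdist q s t hb.1 ht hts'
    have b₁ := hb.2 _ _ hlink
    have b₂ := hbest.2 _ _ hb.1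
    have f₁ := hg.eq_of_dist_le hG (Nat.zero_le n) (y := t) (by omega)
    have f₂ := hg.eq_of_dist_le hG (Nat.zero_le n) (y := s) (by omega)
    rw [zero_add] at f₁ f₂
    have l₁ : G.dist (g 0) t ≤ t₀ := by
      by_contra hlt
      exact hj.disjoint t ht (f₁ ▸ h₂ (G.dist (g 0) t) (by omega) (by omega))
    have l₂ : t₀ < G.dist (g 0) s := by
      by_contra hle
      exact hj.disjoint s (f₂ ▸ h₁ (G.dist (g 0) s) (by omega)) hb.1.end_mem
    have hs' : s = g (t₀ + 1) := by
      rw [show t₀ + 1 = G.dist (g 0) s by omega]; exact f₂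
    refine ⟨?_, hs'⟩
    rw [← hs'] at b₁ b₂
    exact (hb.1.anc.anc_of_dist_le hG ha₂ (by omega)).eq_of_dist_le hG (by omega)
  rw [h.deep_tree'_iff (h₂ n (by omega) le_rfl)]
  refine or_congr_right ⟨?_, fun hc => ⟨_, _, hbest, hc⟩⟩
  rintro ⟨q, s, hb, hc⟩
  obtain ⟨rfl, rfl⟩ := huniq q s hb
  exact hc

/-- Inside $T_j$ the geodesic only descends, and once in $T_j'$ it never returns, because a geodesic
from an ancestor of its end is vertical. The last edge thus descends in $T_j$, crosses, climbs in
$T_j'$ or descends there, and the explicit criteria at its two ends are compared. -/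
theorem Setup.hysteresis (h : Setup G T r B F) {j : ι} {g : ℕ → V} {n : ℕ}
    (hg : Geod G g 0 (n + 1)) (h0 : g 0 = F.root j) (hv : ∀ t ≤ n + 1, g t ∈ F.verts j) :
    (¬ Deep G r F lo hi (g n) → Deep G r F lo hi (g (n + 1)) → hi ≤ G.dist r (g (n + 1))) ∧
    (Deep G r F lo hi (g n) → ¬ Deep G r F lo hi (g (n + 1)) →
      (G.dist r (g (n + 1)) : ℝ) < lo) := by
  classical
  have hj := h.isHam j
  have hG := h.geod
  have htree : ∀ t ≤ n + 1, g t ∈ F.tree j → ∀ t' ≤ t, g t' ∈ F.tree j := by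
    intro t htn ht t' htt'
    have := (hg.mono le_rfl htn).anc_of_anc hG (r := r) (h0 ▸ hj.left.anc _ ht)
      (Nat.zero_le t') htt' le_rfl |>.1
    exact (hv t' (by omega)).resolve_right fun h' => hj.symm.not_anc_of_mem hG h' ht this
  rcases hv (n + 1) le_rfl with hlast | hlast
  · have hp := htree _ le_rfl hlast n (by omega)
    have hd := (hg.anc_of_anc hG (r := r) (h0 ▸ hj.left.anc _ hlast)
      (Nat.zero_le n) (Nat.le_succ n) le_rfl).2
    have hd' : (G.dist r (g n) : ℝ) ≤ G.dist r (g (n + 1)) := by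
      rw [hd]; exact Nat.cast_le.2 (Nat.le_add_right _ _)
    rw [h.deep_tree_iff hlast, h.deep_tree_iff hp]
    constructor
    · rintro h₁ (h₂ | h₂)
      · exact h₂
      · exact absurd (.inr h₂) h₁
    · rintro (h₁ | h₁) h₂
      · exact absurd (.inl (h₁.trans hd')) h₂
      · exact absurd (.inr h₁) h₂
  · obtain ⟨t₀, ht₀, hmem, hmax⟩ : ∃ t₀ ≤ n, g t₀ ∈ F.tree j ∧
        ∀ t, t₀ < t → t ≤ n + 1 → g t ∈ F.tree' j := by
      refine ⟨Nat.findGreatest (fun t => g t ∈ F.tree j) n, Nat.findGreatest_le n,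
        Nat.findGreatest_spec (P := fun t => g t ∈ F.tree j) (Nat.zero_le n)
          (h0 ▸ hj.left.root_mem), fun t ht htn => ?_⟩
      rcases Nat.lt_succ_iff_lt_or_eq.1 (Nat.lt_succ_of_le htn) with htn | rfl
      · exact (hv t (by omega)).resolve_left (Nat.findGreatest_is_greatest ht (by omega))
      · exact hlast
    have hlow := htree t₀ (by omega) hmem
    obtain ⟨m, hm₁, hm₂, hup, hdown⟩ := (hg.mono (a' := t₀ + 1) (by omega) le_rfl).exists_peak hG
      (r := r) (by omega) fun i hi hib => hj.right.inner _ (hmax i (by omega) (by omega)) _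
        (hmax (i + 1) (by omega) (by omega)) (hg.adj (by omega) hib)
    have hchar := h.deep_iff_of_geod (lo := lo) (hi := hi) hg h0 (by omega) hm₂ hlow hmax hup hdown
    -- When the last edge is the cross edge, the end is its own peak and link end, and both
    -- endpoints have the same depth.
    rcases eq_or_lt_of_le ht₀ with rfl | hlt
    · obtain rfl : m = t₀ + 1 := by omega
      have hd := hj.dist_eq hG hmem hlast (hg.adj (Nat.zero_le t₀) (by omega))
      rw [hchar, h.deep_tree_iff hmem, hd]
      constructor
      · rintro h₁ (h₂ | ⟨-, h₂ | h₂⟩)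
        · exact h₂
        · exact absurd (.inr h₂) h₁
        · exact h₂
      · intro h₁ h₂
        by_contra hn
        exact h₂ (.inr ⟨not_lt.1 hn, h₁.symm⟩)
    · have hg' := hg.mono le_rfl (Nat.le_succ n)
      have hmax' : ∀ t, t₀ < t → t ≤ n → g t ∈ F.tree' j := fun t h₁ h₂ => hmax t h₁ (by omega)
      -- While the geodesic climbs, its endpoint is the peak, so the only condition that can newly
      -- fail is the one on `lo`. Once it descends, peak and cross edge are fixed and only the
      -- threshold `hi` at the endpoint can act.
      rcases eq_or_lt_of_le hm₂ with rfl | hmn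
      · have hup' : Climbs G r g (t₀ + 1) n := fun i h₁ h₂ => hup i h₁ (by omega)
        have hchar' := h.deep_iff_of_geod (lo := lo) (hi := hi) hg' h0 hlt le_rfl hlow hmax' hup'
          fun i h₁ h₂ => by omega
        have hd : (G.dist r (g (n + 1)) : ℝ) ≤ G.dist r (g n) := by
          rw [(hup n (by omega) (by omega)).2]; exact Nat.cast_le.2 (Nat.le_succ _)
        have hd' : (G.dist r (g n) : ℝ) ≤ G.dist r (g (t₀ + 1)) := by
          rw [(hup'.anc (by omega)).2]; exact Nat.cast_le.2 (Nat.le_add_right _ _)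
        rw [hchar, hchar']
        constructor
        · rintro h₁ (h₂ | ⟨h₂, h₃⟩)
          · exact h₂
          · exact absurd (.inr ⟨h₂.trans hd, h₃⟩) h₁
        · intro h₁ h₂
          by_contra hn
          refine h₂ (.inr ⟨not_lt.1 hn, ?_⟩)
          rcases h₁ with h₁ | h₁
          · exact .inr (h₁.trans hd')
          · exact h₁.2
      · have hchar' := h.deep_iff_of_geod (lo := lo) (hi := hi) hg' h0 (by omega)
          (by omega : m ≤ n) hlow hmax' hup fun i h₁ h₂ => hdown i h₁ (by omega)
        have hd : (G.dist r (g n) : ℝ) ≤ G.dist r (g (n + 1)) := by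
          rw [(hdown n (by omega) (by omega)).2]; exact Nat.cast_le.2 (Nat.le_succ _)
        rw [hchar, hchar']
        constructor
        · rintro h₁ (h₂ | h₂)
          · exact h₂
          · exact absurd (.inr h₂) h₁
        · rintro (h₁ | h₁) h₂
          · exact absurd (.inl (h₁.trans hd)) h₂
          · exact absurd (.inr h₁) h₂

end Runs

/-! ### Cross edges inside one hammock -/

section Minor

variable {G T : SimpleGraph V} {r : V} {B : Set V} {F : HammockFamily V ι} {f : ℕ → V} {a b : ℕ}

/-- A vertex set closed under taking parents, up to a vertex `ρ` in it, is connected. -/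
theorem connected_of_par_mem (hG : UniqueGeod G) {S : Set V} {ρ : V} (hρ : ρ ∈ S)
    (hS : ∀ v ∈ S, v ≠ ρ → v ≠ r ∧ par G r v ∈ S) : (G.induce S).Connected := by
  have key : ∀ n, ∀ v (hv : v ∈ S), G.dist r v = n →
      (G.induce S).Reachable ⟨v, hv⟩ ⟨ρ, hρ⟩ := by
    intro n
    induction n using Nat.strong_induction_on with
    | _ n ih =>
      intro v hv hn
      by_cases e : v = ρ
      · subst e; exact .refl _
      · obtain ⟨h₁, h₂⟩ := hS v hv e
        obtain ⟨h₃, h₄⟩ := par_spec hG h₁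
        have hadj : (G.induce S).Adj ⟨v, hv⟩ ⟨par G r v, h₂⟩ := h₃.symm
        exact hadj.reachable.trans (ih _ (by omega) _ h₂ rfl)
  exact { preconnected := fun u v => (key _ u.1 u.2 rfl).trans (key _ v.1 v.2 rfl).symm
          nonempty := ⟨⟨ρ, hρ⟩⟩ }

/-- The vertices of a geodesic form a connected set. -/
theorem Geod.connected (hf : Geod G f a b) (hab : a ≤ b) :
    (G.induce {v | ∃ t, a ≤ t ∧ t ≤ b ∧ f t = v}).Connected := by
  have key : ∀ t, a ≤ t → ∀ ht : t ≤ b, ∀ ha : a ≤ t,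
      (G.induce {v | ∃ t, a ≤ t ∧ t ≤ b ∧ f t = v}).Reachable
        ⟨f a, a, le_rfl, hab, rfl⟩ ⟨f t, t, ha, ht, rfl⟩ := by
    intro t hat
    induction t, hat using Nat.le_induction with
    | base => exact fun _ _ => .refl _
    | succ t hat ih =>
      intro ht _
      refine (ih (by omega) hat).trans (SimpleGraph.Adj.reachable ?_)
      exact hf.adj hat (by omega)
  refine { preconnected := ?_, nonempty := ⟨⟨f a, a, le_rfl, hab, rfl⟩⟩ }
  rintro ⟨_, t, h₁, h₂, rfl⟩ ⟨_, s, h₃, h₄, rfl⟩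
  exact (key t h₁ h₂ h₁).symm.trans (key s h₃ h₄ h₃)

/-- The ends of a geodesic with a cross edge are unrelated. -/
theorem Geod.not_anc (hG : UniqueGeod G) (hf : Geod G f a b) {c i j : ℕ} (hi : a ≤ i)
    (hic : i ≤ c) (hcj : c < j) (hj : j ≤ b) (hc : G.dist r (f c) = G.dist r (f (c + 1))) :
    ¬ Anc G r (f i) (f j) ∧ ¬ Anc G r (f j) (f i) := by
  constructor
  · intro h
    have := ((hf.mono hi hj).anc_of_anc hG h hic (Nat.le_add_right c 1) hcj).2
    omega
  · intro h
    have hr := hf.reverse (c := j) (n := j - i) hj (by omega)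
    have := (hr.anc_of_anc hG (r := r) (i := j - (c + 1)) (j := j - c)
      (by simpa [show j - (j - i) = i by omega] using h) (by omega) (by omega) (by omega)).2
    simp only [show j - (j - (c + 1)) = c + 1 by omega, show j - (j - c) = c by omega] at this
    omega

/-- If a geodesic visits the parent of an ancestor `z` of its start, it visits `z`. -/
theorem Geod.exists_eq_of_par (hG : UniqueGeod G) {t : ℕ} {z : V} (hf : Geod G f a t)
    (hat : a ≤ t) (hz : Anc G r z (f a)) (hzr : z ≠ r) (e : f t = par G r z) :
    ∃ s, a ≤ s ∧ s ≤ t ∧ f s = z := by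
  have ht : ∀ i, a ≤ i → i ≤ t → f i = (par G r)^[i - a] (f a) := fun i hi hit =>
    hf.eq_iterate_of_anc hG (by rw [e]; exact (anc_par G r z).trans hz) hi hit
  obtain ⟨k₁, e₁⟩ := (anc_iff_iterate hG).1 hz
  have hdz := (par_spec hG hzr).2
  have hdt : G.dist r (f t) = G.dist r (f a) - (t - a) := by
    rw [ht t hat le_rfl, dist_par_iterate hG]
  rw [e] at hdt
  refine ⟨a + (G.dist r (f a) - G.dist r z), by omega, by omega, ?_⟩
  rw [ht _ (by omega) (by omega), Nat.add_sub_cancel_left]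
  exact e₁

/-- Climbing from a vertex in `S` to an ancestor outside of `S` one leaves `S` somewhere. -/
theorem exists_par_notMem {S : Set V} {u v : V} (hv : v ∈ S) (huv : Anc G r u v) (hu : u ∉ S) :
    ∃ z ∈ S, Anc G r z v ∧ par G r z ∉ S ∧ Anc G r u (par G r z) := by
  obtain ⟨i, rfl⟩ := huv
  induction i generalizing v with
  | zero => exact absurd hv hu
  | succ i ih =>
    rw [Function.iterate_succ_apply] at hu ⊢
    by_cases hp : par G r v ∈ S
    · obtain ⟨z, h₁, h₂, h₃, h₄⟩ := ih hp hu
      exact ⟨z, h₁, h₂.trans (anc_par G r v), h₃, h₄⟩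
    · exact ⟨v, hv, Anc.refl _ _ _, hp, i, rfl⟩

/-- A geodesic that crosses a hammock three times yields a `K₄` minor. -/
theorem IsHam.hasK4Minor {V₁ V₂ : Set V} {r₁ r₂ : V} (hG : UniqueGeod G)
    (h : IsHam G r V₁ V₂ r₁ r₂) (hf : Geod G f a b) {c₁ c₂ c₃ : ℕ} (ha : a ≤ c₁)
    (h₁₂ : c₁ < c₂) (h₂₃ : c₂ < c₃) (hb : c₃ < b) (m₁ : f c₁ ∈ V₁)
    (m₂ : ∀ t, c₁ < t → t ≤ c₂ → f t ∈ V₂) (m₃ : ∀ t, c₂ < t → t ≤ c₃ → f t ∈ V₁)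
    (m₄ : f (c₃ + 1) ∈ V₂) : HasK4Minor G := by
  have hc₁ := h.dist_eq hG m₁ (m₂ (c₁ + 1) (by omega) (by omega)) (hf.adj ha (by omega))
  have hc₂ := h.symm.dist_eq hG (m₂ c₂ h₁₂ le_rfl) (m₃ (c₂ + 1) (by omega) (by omega))
    (hf.adj (by omega) (by omega))
  have hr₁ : ∀ v ∈ V₁, v ≠ r := fun v hv => h.ne_root_left hG hv
  have hr₂ : ∀ v ∈ V₂, v ≠ r := fun v hv => h.symm.ne_root_left hG hv
  -- The four supernodes: `Y` is `f c₁` with the first stretch in `V₂`, `X` is the next stretch in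
  -- `V₁`, `D` joins `r₂` to the later part of the geodesic inside `V₂` around `Y`, and `A` joins
  -- the two sides from above through `r`.
  set Y : Set V := {v | ∃ t, c₁ ≤ t ∧ t ≤ c₂ ∧ f t = v}
  set X : Set V := {v | ∃ t, c₂ + 1 ≤ t ∧ t ≤ c₃ ∧ f t = v}
  set A : Set V := {z | (Anc G r z (f c₁) ∨ Anc G r z (f (c₂ + 1)) ∨ Anc G r z r₂) ∧
    z ∉ X ∧ z ≠ f c₁ ∧ z ∉ V₂}
  set D : Set V := {z | z ∈ V₂ ∧ z ∉ Y ∧ (Anc G r z (f (c₃ + 1)) ∨ Anc G r z (f (c₁ + 1)))}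
  have hXV : ∀ z ∈ X, z ∈ V₁ := by
    rintro _ ⟨t, h₁, h₂, rfl⟩; exact m₃ t (by omega) h₂
  have hYV : ∀ z ∈ Y, z ∈ V₁ → z = f c₁ := by
    rintro _ ⟨t, h₁, h₂, rfl⟩ hz
    rcases eq_or_lt_of_le h₁ with rfl | h₁
    · rfl
    · exact (h.disjoint _ hz (m₂ t h₁ h₂)).elim
  -- ancestors of `f c₁` avoid `X`, and ancestors of `f (c₂ + 1)` avoid `f c₁`
  have hX₁ : ∀ z ∈ X, ¬ Anc G r z (f c₁) := by
    rintro _ ⟨t, h₁, h₂, rfl⟩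
    exact (hf.not_anc hG ha le_rfl (by omega) (by omega) hc₁).2
  have hx₂ : ¬ Anc G r (f c₁) (f (c₂ + 1)) :=
    (hf.not_anc hG ha le_rfl (by omega) (by omega) hc₁).1
  have hV₂ : ∀ z ∈ V₂, ¬ Anc G r z (f c₁) ∧ ¬ Anc G r z (f (c₂ + 1)) := fun z hz =>
    ⟨h.symm.not_anc_of_mem hG hz m₁,
      h.symm.not_anc_of_mem hG hz (m₃ _ (by omega) (by omega))⟩
  have hV₁ : ∀ z ∈ V₁, ¬ Anc G r z r₂ := fun z hz =>
    h.not_anc_of_mem hG hz h.right.root_mem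
  have hYD : ∀ z ∈ Y, ¬ Anc G r z (f (c₃ + 1)) ∧ ¬ Anc G r (f (c₃ + 1)) z := by
    rintro _ ⟨t, h₁, h₂, rfl⟩
    exact hf.not_anc hG (by omega) h₂ (by omega) (by omega) hc₂
  have hparV₂ : par G r r₂ ∉ V₂ := fun hp => by
    have := (anc_par G r r₂).antisymm hG (h.right.anc _ hp)
    have h' := (par_spec hG (hr₂ _ h.right.root_mem)).2
    rw [this] at h'; omega
  have hrA : r ∈ A := ⟨.inl (anc_root hG _), fun hz => hr₁ r (hXV r hz) rfl,
    fun e => hr₁ _ m₁ e.symm, fun hz => hr₂ r hz rfl⟩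
  have hAconn : (G.induce A).Connected := by
    refine connected_of_par_mem hG hrA fun z hz hzr => ⟨hzr, ?_⟩
    obtain ⟨hz₁, hz₂, hz₃, hz₄⟩ := hz
    have hpar : Anc G r (par G r z) (f c₁) ∨ Anc G r (par G r z) (f (c₂ + 1)) ∨
        Anc G r (par G r z) r₂ :=
      hz₁.imp (anc_par G r z).trans (Or.imp (anc_par G r z).trans (anc_par G r z).trans)
    refine ⟨hpar, ?_, ?_, ?_⟩
    · intro hp
      rcases hz₁ with h' | h' | h'
      · exact hX₁ _ hp ((anc_par G r z).trans h')
      · obtain ⟨t, h₁, h₂, e⟩ := hp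
        obtain ⟨t', l₁, l₂, e'⟩ :=
          (hf.mono (a' := c₂ + 1) (b' := t) (by omega) (by omega)).exists_eq_of_par hG h₁ h' hzr e
        exact hz₂ ⟨t', l₁, by omega, e'⟩
      · exact hV₁ _ (hXV _ hp) ((anc_par G r z).trans h')
    · intro hp
      rcases hz₁ with h' | h' | h'
      · have := h'.dist_le hG
        have h'' := (par_spec hG hzr).2
        rw [hp] at h''
        omega
      · exact hx₂ (hp ▸ (anc_par G r z).trans h')
      · exact hV₁ _ m₁ (hp ▸ (anc_par G r z).trans h')
    · intro hp
      rcases hz₁ with h' | h' | h'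
      · exact (hV₂ _ hp).1 ((anc_par G r z).trans h')
      · exact (hV₂ _ hp).2 ((anc_par G r z).trans h')
      · have := ((h.right.anc _ hp).trans (anc_par G r z)).antisymm hG h'
        exact hz₄ (this ▸ h.right.root_mem)
  have hrootD : r₂ ∈ D := by
    refine ⟨h.right.root_mem, fun hz => ?_, .inl (h.right.anc _ m₄)⟩
    exact (hYD _ hz).1 (h.right.anc _ m₄)
  have hDconn : (G.induce D).Connected := by
    refine connected_of_par_mem hG hrootD fun z hz hzr => ⟨hr₂ _ hz.1, ?_⟩
    obtain ⟨hz₁, hz₂, hz₃⟩ := hz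
    refine ⟨h.right.par_mem z hz₁ hzr, fun hp => ?_,
      hz₃.imp (anc_par G r z).trans (anc_par G r z).trans⟩
    rcases hz₃ with h' | h'
    · exact (hYD _ hp).1 ((anc_par G r z).trans h')
    · have hpV : par G r z ∈ V₂ := h.right.par_mem z hz₁ hzr
      obtain ⟨t, h₁, h₂, e⟩ := hp
      have h₁' : c₁ + 1 ≤ t := by
        rcases eq_or_lt_of_le h₁ with rfl | h₁
        · exact (h.disjoint _ m₁ (e ▸ hpV)).elim
        · exact h₁
      obtain ⟨t', l₁, l₂, e'⟩ := (hf.mono (a' := c₁ + 1) (b' := t) (by omega)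
        (by omega)).exists_eq_of_par hG h₁' h' (hr₂ _ hz₁) e
      exact hz₂ ⟨t', by omega, by omega, e'⟩
  have hXconn : (G.induce X).Connected :=
    (hf.mono (by omega) (by omega) : Geod G f (c₂ + 1) c₃).connected (by omega)
  have hYconn : (G.induce Y).Connected :=
    (hf.mono ha (by omega) : Geod G f c₁ c₂).connected (by omega)
  have hAX : Disjoint A X := Set.disjoint_left.2 fun z hz hz' => hz.2.1 hz'
  have hAY : Disjoint A Y := Set.disjoint_left.2 fun z hz hz' => by
    obtain ⟨t, h₁, h₂, rfl⟩ := hz'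
    rcases eq_or_lt_of_le h₁ with rfl | h₁
    · exact hz.2.2.1 rfl
    · exact hz.2.2.2 (m₂ t h₁ h₂)
  have hAD : Disjoint A D := Set.disjoint_left.2 fun z hz hz' => hz.2.2.2 hz'.1
  have hXY : Disjoint X Y := Set.disjoint_left.2 fun z hz hz' => by
    have e := hYV z hz' (hXV z hz)
    exact hX₁ z hz (e ▸ Anc.refl _ _ _)
  have hXD : Disjoint X D := Set.disjoint_left.2 fun z hz hz' => h.disjoint z (hXV z hz) hz'.1
  have hYD' : Disjoint Y D := Set.disjoint_left.2 fun z hz hz' => hz'.2.1 hz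
  have eAY : ∃ u ∈ A, ∃ v ∈ Y, G.Adj u v := by
    obtain ⟨p₁, p₂⟩ := par_spec hG (hr₁ _ m₁)
    refine ⟨par G r (f c₁), ⟨.inl (anc_par G r _), fun hp => hX₁ _ hp (anc_par G r _), ?_,
      fun hp => (hV₂ _ hp).1 (anc_par G r _)⟩, f c₁, ⟨c₁, le_rfl, by omega, rfl⟩, p₁⟩
    intro e
    rw [e] at p₂; omega
  have eAX : ∃ u ∈ A, ∃ v ∈ X, G.Adj u v := by
    obtain ⟨z, hz, hz₁, hz₂, -⟩ := exists_par_notMem (S := X) (u := r) (v := f (c₂ + 1))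
      ⟨c₂ + 1, le_rfl, by omega, rfl⟩ (anc_root hG _) fun hz => hr₁ r (hXV r hz) rfl
    have ha' := (anc_par G r z).trans hz₁
    refine ⟨par G r z, ⟨.inr (.inl ha'), hz₂, fun e => hx₂ (e ▸ ha'),
      fun hp => (hV₂ _ hp).2 ha'⟩, z, hz, (par_spec hG (hr₁ _ (hXV z hz))).1⟩
  -- `A` and `D` meet along the parent edge of `r₂`. The edges `X`–`Y` and `X`–`D` are the second
  -- and third crossings; `A`–`X` and `Y`–`D` arise where a tree path upwards leaves the geodesic
  -- stretch.
  have eAD : ∃ u ∈ A, ∃ v ∈ D, G.Adj u v := by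
    refine ⟨par G r r₂, ⟨.inr (.inr (anc_par G r _)), fun hp => hV₁ _ (hXV _ hp) (anc_par G r _),
      fun e => hV₁ _ m₁ (e ▸ anc_par G r _), hparV₂⟩, r₂, hrootD,
      (par_spec hG (hr₂ _ h.right.root_mem)).1⟩
  have eXY : ∃ u ∈ X, ∃ v ∈ Y, G.Adj u v :=
    ⟨f (c₂ + 1), ⟨c₂ + 1, le_rfl, by omega, rfl⟩, f c₂, ⟨c₂, by omega, le_rfl, rfl⟩,
      (hf.adj (by omega) (by omega)).symm⟩
  have eXD : ∃ u ∈ X, ∃ v ∈ D, G.Adj u v :=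
    ⟨f c₃, ⟨c₃, by omega, le_rfl, rfl⟩, f (c₃ + 1),
      ⟨m₄, fun hz => (hYD _ hz).1 (Anc.refl _ _ _), .inl (Anc.refl _ _ _)⟩,
      hf.adj (by omega) hb⟩
  have eYD : ∃ u ∈ Y, ∃ v ∈ D, G.Adj u v := by
    have hm := m₂ (c₁ + 1) (by omega) (by omega)
    obtain ⟨z, hz, hz₁, hz₂, hz₃⟩ := exists_par_notMem (S := Y) (u := r₂) (v := f (c₁ + 1))
      ⟨c₁ + 1, by omega, by omega, rfl⟩ (h.right.anc _ hm) hrootD.2.1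
    have ha' := (anc_par G r z).trans hz₁
    have hzV : z ∈ V₂ := h.right.mem_of_anc hG hm hz₁ (hz₃.trans (anc_par G r z))
    exact ⟨z, hz, par G r z, ⟨h.right.mem_of_anc hG hm ha' hz₃, hz₂, .inr ha'⟩,
      (par_spec hG (hr₂ _ hzV)).1.symm⟩
  have flip : ∀ {P Q : Set V}, (∃ u ∈ P, ∃ v ∈ Q, G.Adj u v) → ∃ u ∈ Q, ∃ v ∈ P, G.Adj u v := by
    rintro P Q ⟨u, hu, v, hv, huv⟩
    exact ⟨v, hv, u, hu, huv.symm⟩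
  refine ⟨![A, X, Y, D], ?_, ?_, ?_⟩
  · intro i
    fin_cases i
    · exact hAconn
    · exact hXconn
    · exact hYconn
    · exact hDconn
  · intro i j hij
    fin_cases i <;> fin_cases j
    · exact absurd rfl hij
    · exact hAX
    · exact hAY
    · exact hAD
    · exact hAX.symm
    · exact absurd rfl hij
    · exact hXY
    · exact hXD
    · exact hAY.symm
    · exact hXY.symm
    · exact absurd rfl hij
    · exact hYD'
    · exact hAD.symm
    · exact hXD.symm
    · exact hYD'.symm
    · exact absurd rfl hij
  · intro i j hij
    fin_cases i <;> fin_cases j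
    · exact absurd rfl hij
    · exact eAX
    · exact eAY
    · exact eAD
    · exact flip eAX
    · exact absurd rfl hij
    · exact eXY
    · exact eXD
    · exact flip eAY
    · exact flip eXY
    · exact absurd rfl hij
    · exact eYD
    · exact flip eAD
    · exact flip eXD
    · exact flip eYD
    · exact absurd rfl hij

end Minor

/-! ### Cross edges and cuts of a geodesic -/

section Count

variable {G T : SimpleGraph V} {r : V} {B : Set V} {F : HammockFamily V ι} {f : ℕ → V} {a b : ℕ}
  {lo hi : ℝ}

theorem exists_first_cross (h : crossCount G r f a b ≠ 0) :
    ∃ c, a ≤ c ∧ c < b ∧ G.dist r (f c) = G.dist r (f (c + 1)) ∧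
      (∀ i, a ≤ i → i < c → G.dist r (f i) ≠ G.dist r (f (i + 1))) ∧
      crossCount G r f a b ≤ crossCount G r f (c + 1) b + 1 := by
  classical
  have hex : ∃ c, a ≤ c ∧ c < b ∧ G.dist r (f c) = G.dist r (f (c + 1)) := by
    obtain ⟨c, hc⟩ := Finset.card_ne_zero.1 h
    simp only [Finset.mem_filter, Finset.mem_Ico] at hc
    exact ⟨c, hc.1.1, hc.1.2, hc.2⟩
  obtain ⟨h₁, h₂, h₃⟩ := Nat.find_spec hex
  refine ⟨Nat.find hex, h₁, h₂, h₃, fun i hi hic e => ?_, ?_⟩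
  · exact Nat.find_min hex hic ⟨hi, by omega, e⟩
  · rw [crossCount, crossCount]
    refine (Finset.card_le_card fun i hi => ?_).trans (Finset.card_insert_le (Nat.find hex) _)
    simp only [Finset.mem_insert, Finset.mem_filter, Finset.mem_Ico] at hi ⊢
    have := Nat.find_min' hex ⟨hi.1.1, hi.1.2, hi.2⟩
    by_cases e : i = Nat.find hex
    · exact .inl e
    · exact .inr ⟨⟨by omega, hi.1.2⟩, hi.2⟩

theorem IsHam.mem_left_of_no_cross {V₁ V₂ : Set V} {r₁ r₂ : V} (hG : UniqueGeod G)
    (h : IsHam G r V₁ V₂ r₁ r₂) (hf : Geod G f a b) (hv : ∀ t, a ≤ t → t ≤ b → f t ∈ V₁ ∪ V₂)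
    (hc : ∀ i, a ≤ i → i < b → G.dist r (f i) ≠ G.dist r (f (i + 1))) (ha : f a ∈ V₁) :
    ∀ t, a ≤ t → t ≤ b → f t ∈ V₁ := by
  intro t hat
  induction t, hat using Nat.le_induction with
  | base => exact fun _ => ha
  | succ t hat ih =>
    intro htb
    refine (hv (t + 1) (by omega) htb).resolve_right fun h' => ?_
    exact hc t hat (by omega) (h.dist_eq hG (ih (by omega)) h' (hf.adj hat (by omega)))

/-- A geodesic inside a hammock has at most two cross edges. -/
theorem IsHam.crossCount_le_two {V₁ V₂ : Set V} {r₁ r₂ : V} (hG : UniqueGeod G)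
    (hsp : SeriesParallel G) (h : IsHam G r V₁ V₂ r₁ r₂) (hf : Geod G f a b)
    (hv : ∀ t, a ≤ t → t ≤ b → f t ∈ V₁ ∪ V₂) : crossCount G r f a b ≤ 2 := by
  by_contra hgt
  obtain ⟨c₁, ha₁, hb₁, e₁, n₁, k₁⟩ := exists_first_cross (G := G) (r := r) (f := f) (a := a)
    (b := b) (by omega)
  obtain ⟨c₂, ha₂, hb₂, e₂, n₂, k₂⟩ := exists_first_cross (G := G) (r := r) (f := f) (a := c₁ + 1)
    (b := b) (by omega)
  obtain ⟨c₃, ha₃, hb₃, e₃, n₃, k₃⟩ := exists_first_cross (G := G) (r := r) (f := f) (a := c₂ + 1)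
    (b := b) (by omega)
  -- Horizontal edges must change sides and other edges cannot, so three consecutive cross edges
  -- alternate as the minor requires; the sides are quantified so that either may come first.
  have key : ∀ {V₁ V₂ : Set V} {r₁ r₂ : V}, IsHam G r V₁ V₂ r₁ r₂ →
      (∀ t, a ≤ t → t ≤ b → f t ∈ V₁ ∪ V₂) → f c₁ ∈ V₁ → False := by
    intro V₁ V₂ r₁ r₂ h hv m₁
    have hv' : ∀ t, a ≤ t → t ≤ b → f t ∈ V₂ ∪ V₁ := fun t h₁ h₂ => (hv t h₁ h₂).symm
    have m₂ : f (c₁ + 1) ∈ V₂ := (hv (c₁ + 1) (by omega) (by omega)).resolve_left fun h' =>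
      h.left.inner _ m₁ _ h' (hf.adj (by omega) (by omega)) e₁
    have m₂' := h.symm.mem_left_of_no_cross hG
      (hf.mono (a' := c₁ + 1) (b' := c₂) (by omega) (by omega))
      (fun t h₁ h₂ => hv' t (by omega) (by omega)) n₂ m₂
    have m₃ : f (c₂ + 1) ∈ V₁ := (hv (c₂ + 1) (by omega) (by omega)).resolve_right fun h' =>
      h.right.inner _ (m₂' c₂ ha₂ le_rfl) _ h' (hf.adj (by omega) (by omega)) e₂
    have m₃' := h.mem_left_of_no_cross hG
      (hf.mono (a' := c₂ + 1) (b' := c₃) (by omega) (by omega))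
      (fun t h₁ h₂ => hv t (by omega) (by omega)) n₃ m₃
    have m₄ : f (c₃ + 1) ∈ V₂ := (hv (c₃ + 1) (by omega) (by omega)).resolve_left fun h' =>
      h.left.inner _ (m₃' c₃ ha₃ le_rfl) _ h' (hf.adj (by omega) (by omega)) e₃
    exact hsp (h.hasK4Minor hG hf ha₁ ha₂ ha₃ hb₃ m₁ m₂' m₃' m₄)
  rcases hv c₁ ha₁ hb₁.le with m₁ | m₁
  · exact key h hv m₁
  · exact key h.symm (fun t h₁ h₂ => (hv t h₁ h₂).symm) m₁

/-! ### Geodesics in the forest of hammocks -/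

theorem Setup.mem_verts_of_geod (h : Setup G T r B F) {j : ι} (hf : Geod G f a b)
    (hab : a ≤ b) (hM : ∀ i, a ≤ i → i < b → (F.union G).Adj (f i) (f (i + 1)))
    (ha : f a ∈ F.verts j) (hb : f b ∈ F.verts j) :
    ∀ t, a ≤ t → t ≤ b → f t ∈ F.verts j := by
  obtain ⟨n, rfl⟩ := Nat.exists_eq_add_of_le hab
  obtain ⟨p, -, hs⟩ := exists_walk_of_adj (F.union G) f a n
    fun i hi => hM (a + i) (by omega) (by omega)
  have hp : p.IsPath := by
    rw [SimpleGraph.Walk.isPath_def, hs]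
    refine List.Nodup.map_on ?_ List.nodup_range
    intro i hi i' hi' e
    rw [List.mem_range] at hi hi'
    have := hf.inj (by omega) (by omega) (by omega) (by omega) e
    omega
  intro t hat htb
  refine h.convex hp ha hb _ ?_
  rw [hs, List.mem_map]
  exact ⟨t - a, by rw [List.mem_range]; omega, by rw [Nat.add_sub_cancel' hat]⟩

/-- The `i`-th edge of `f` lies in a hammock whose root is visited later. -/
def IsUp (G : SimpleGraph V) (F : HammockFamily V ι) (f : ℕ → V) (b i : ℕ) : Prop :=
  ∃ j c, (F.graph G j).Adj (f i) (f (i + 1)) ∧ i < c ∧ c ≤ b ∧ f c = F.root j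

/-- The `i`-th edge of `f` lies in a hammock whose root was visited before. -/
def IsDown (G : SimpleGraph V) (F : HammockFamily V ι) (f : ℕ → V) (a i : ℕ) : Prop :=
  ∃ j c, (F.graph G j).Adj (f i) (f (i + 1)) ∧ a ≤ c ∧ c ≤ i ∧ f c = F.root j

theorem abs_dist_sub_le (hG : UniqueGeod G) (hf : Geod G f a b) {i j : ℕ} (hi : a ≤ i)
    (hij : i ≤ j) (hj : j ≤ b) :
    |(G.dist r (f i) : ℝ) - G.dist r (f j)| ≤ (j : ℝ) - i := by
  have h₀ := hf i j hi hij hj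
  have h₁ := hG.conn.dist_triangle (u := r) (v := f i) (w := f j)
  have h₂ := hG.conn.dist_triangle (u := r) (v := f j) (w := f i)
  rw [SimpleGraph.dist_comm (u := f j)] at h₂
  have e₀ : (G.dist (f i) (f j) : ℝ) + i = j := by exact_mod_cast h₀
  have e₁ : (G.dist r (f j) : ℝ) ≤ G.dist r (f i) + G.dist (f i) (f j) := by exact_mod_cast h₁
  have e₂ : (G.dist r (f i) : ℝ) ≤ G.dist r (f j) + G.dist (f i) (f j) := by exact_mod_cast h₂
  rw [abs_le]
  constructor <;> linarith

/-- Each edge is the last edge of a geodesic from its own hammock root, which stays in that hammock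
by convexity. The switching rule therefore holds at every edge, even though the hammocks vary along
the way. -/
theorem Setup.cuts_down_le_two (h : Setup G T r B F) {m : ℕ} (hf : Geod G f a b) (ham : a ≤ m)
    (hM : ∀ i, a ≤ i → i < b → (F.union G).Adj (f i) (f (i + 1))) (hlh : lo < hi)
    (hlen : (b : ℝ) - m ≤ 2 * (hi - lo)) (hd : ∀ i, m ≤ i → i < b → IsDown G F f a i) :
    cuts (fun i => Deep G r F lo hi (f i)) m b ≤ 2 := by
  have key : ∀ i, m ≤ i → i < b →
      (¬ Deep G r F lo hi (f i) → Deep G r F lo hi (f (i + 1)) → hi ≤ G.dist r (f (i + 1))) ∧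
      (Deep G r F lo hi (f i) → ¬ Deep G r F lo hi (f (i + 1)) →
        (G.dist r (f (i + 1)) : ℝ) < lo) := by
    intro i hmi hib
    obtain ⟨j, c, hadj, hac, hci, hc⟩ := hd i hmi hib
    have hmem := h.mem_verts_of_geod (hf.mono (a' := c) (b' := i + 1) hac (by omega)) (by omega)
      (fun t h₁ h₂ => hM t (by omega) (by omega)) (hc ▸ h.root_mem j) hadj.2.2
    have := h.hysteresis (lo := lo) (hi := hi) (j := j) (n := i - c)
      (hf.shift (n := i - c + 1) hac (by omega))
      hc (fun t ht => hmem (c + t) (by omega) (by omega))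
    simpa only [show c + (i - c) = i by omega, show c + (i - c + 1) = i + 1 by omega] using this
  exact cuts_le_two_of_hysteresis (D := fun i => G.dist r (f i))
    (fun i j hi hij hj => abs_dist_sub_le h.geod hf (by omega) hij hj)
    (fun i h₁ h₂ => (key i h₁ h₂).1) (fun i h₁ h₂ => (key i h₁ h₂).2) hlh hlen

/-- The mirror image of the descending case: read backwards, every edge comes after its hammock
root. -/
theorem Setup.cuts_up_le_two (h : Setup G T r B F) {m : ℕ} (hf : Geod G f a b) (ham : a ≤ m)
    (hmb : m ≤ b) (hM : ∀ i, a ≤ i → i < b → (F.union G).Adj (f i) (f (i + 1))) (hlh : lo < hi)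
    (hlen : (m : ℝ) - a ≤ 2 * (hi - lo)) (hd : ∀ i, a ≤ i → i < m → IsUp G F f b i) :
    cuts (fun i => Deep G r F lo hi (f i)) a m ≤ 2 := by
  rw [cuts_reverse _ ham]
  have hg' := hf.reverse (c := m) (n := m - a) hmb (by omega)
  have key : ∀ i, 0 ≤ i → i < m - a →
      (¬ Deep G r F lo hi (f (m - i)) → Deep G r F lo hi (f (m - (i + 1))) →
        hi ≤ G.dist r (f (m - (i + 1)))) ∧
      (Deep G r F lo hi (f (m - i)) → ¬ Deep G r F lo hi (f (m - (i + 1))) →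
        (G.dist r (f (m - (i + 1))) : ℝ) < lo) := by
    intro i _ hi'
    obtain ⟨j, c, hadj, hac, hcb, hc⟩ := hd (m - (i + 1)) (by omega) (by omega)
    have hmem := h.mem_verts_of_geod (hf.mono (a' := m - (i + 1)) (b' := c) (by omega) hcb)
      (by omega) (fun t h₁ h₂ => hM t (by omega) (by omega)) hadj.2.1 (hc ▸ h.root_mem j)
    have := h.hysteresis (lo := lo) (hi := hi) (j := j) (n := c - (m - i))
      (hf.reverse (c := c) (n := c - (m - i) + 1) hcb (by omega))
      hc (fun t ht => hmem (c - t) (by omega) (by omega))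
    simpa only [show c - (c - (m - i)) = m - i by omega,
      show c - (c - (m - i) + 1) = m - (i + 1) by omega] using this
  refine cuts_le_two_of_hysteresis (D := fun i => G.dist r (f (m - i)))
    (fun i j hi hij hj => abs_dist_sub_le h.geod hg' hi hij hj)
    (fun i h₁ h₂ => (key i h₁ h₂).1) (fun i h₁ h₂ => (key i h₁ h₂).2) hlh ?_
  rw [Nat.cast_sub ham]
  simpa using hlen

/-- A geodesic in the forest of hammocks goes up to a hammock, through it, and down again. -/
theorem Setup.cuts_forest_le (h : Setup G T r B F) (hsp : SeriesParallel G) (hf : Geod G f a b)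
    (hab : a ≤ b) (hM : ∀ i, a ≤ i → i < b → (F.union G).Adj (f i) (f (i + 1))) (hlh : lo < hi)
    (hlen : (b : ℝ) - a ≤ 2 * (hi - lo)) :
    cuts (fun i => Deep G r F lo hi (f i)) a b ≤ 12 := by
  classical
  obtain ⟨m₁, ham₁, hm₁b, hup, hm₁⟩ : ∃ m, a ≤ m ∧ m ≤ b ∧
      (∀ i, a ≤ i → i < m → IsUp G F f b i) ∧ (m < b → ¬ IsUp G F f b m) := by
    have hex : ∃ m, a ≤ m ∧ (m < b → ¬ IsUp G F f b m) := ⟨b, hab, fun h' => by omega⟩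
    have hle : Nat.find hex ≤ b := Nat.find_min' hex ⟨hab, fun h' => by omega⟩
    refine ⟨Nat.find hex, (Nat.find_spec hex).1, hle, fun i hi hlt => ?_, (Nat.find_spec hex).2⟩
    by_contra hn
    exact Nat.find_min hex hlt ⟨hi, fun _ => hn⟩
  obtain ⟨m₂, hm₁₂, hm₂b, hnd, hm₂⟩ : ∃ m, m₁ ≤ m ∧ m ≤ b ∧
      (∀ i, m₁ ≤ i → i < m → ¬ IsDown G F f a i) ∧ (m < b → IsDown G F f a m) := by
    have hex : ∃ m, m₁ ≤ m ∧ (m < b → IsDown G F f a m) := ⟨b, hm₁b, fun h' => by omega⟩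
    have hle : Nat.find hex ≤ b := Nat.find_min' hex ⟨hm₁b, fun h' => by omega⟩
    refine ⟨Nat.find hex, (Nat.find_spec hex).1, hle, fun i hi hlt hn => ?_,
      (Nat.find_spec hex).2⟩
    exact Nat.find_min hex hlt ⟨hi, fun _ => hn⟩
  -- The geodesic can change hammocks only at a root of one of them, and the root of the hammock
  -- being left would make edge `i` an up-edge.
  have hstep : ∀ i j j', a ≤ i → i + 1 < b → ¬ IsUp G F f b i →
      (F.graph G j).Adj (f i) (f (i + 1)) → (F.graph G j').Adj (f (i + 1)) (f (i + 1 + 1)) →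
      j = j' ∨ f (i + 1) = F.root j' := by
    intro i j j' hi hib hn hj hj'
    by_contra hne
    push Not at hne
    exact hne.1 (h.eq_of_mem hj.2.2 hj'.2.1
      (fun e => hn ⟨j, i + 1, hj, by omega, by omega, e⟩) hne.2)
  -- A new up-edge would either share its hammock with the previous edge, making that one up as
  -- well, or start at its hammock root and visit this root a second time.
  have hnotup : ∀ i, m₁ ≤ i → i < b → ¬ IsUp G F f b i := by
    intro i hi
    induction i, hi using Nat.le_induction with
    | base => exact hm₁
    | succ i hi ih =>
      rintro hib ⟨j', c, hj', hic, hcb, hc⟩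
      obtain ⟨j, hj⟩ := union_adj.1 (hM i (by omega) (by omega))
      rcases hstep i j j' (by omega) hib (ih (by omega)) hj hj' with rfl | e
      · exact ih (by omega) ⟨j, c, hj, by omega, hcb, hc⟩
      · have := hf.inj (by omega) (by omega) (by omega) hcb (e.trans hc.symm)
        omega
  have hdown : ∀ i, m₂ ≤ i → i < b → IsDown G F f a i := by
    intro i hi
    induction i, hi using Nat.le_induction with
    | base => exact hm₂
    | succ i hi ih =>
      intro hib
      obtain ⟨j, c, hj, hac, hci, hc⟩ := ih (by omega)
      obtain ⟨j', hj'⟩ := union_adj.1 (hM (i + 1) (by omega) (by omega))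
      rcases hstep i j j' (by omega) hib (hnotup i (by omega) (by omega)) hj hj' with rfl | e
      · exact ⟨j, c, hj', hac, by omega, hc⟩
      · exact ⟨j', i + 1, hj', by omega, le_rfl, e⟩
  have hcast₁ : (a : ℝ) ≤ m₁ := Nat.cast_le.2 ham₁
  have hcast₂ : (m₁ : ℝ) ≤ b := Nat.cast_le.2 hm₁b
  have hcast₃ : (a : ℝ) ≤ m₂ := Nat.cast_le.2 (ham₁.trans hm₁₂)
  have b₁ := h.cuts_up_le_two (lo := lo) (hi := hi) hf ham₁ hm₁b hM hlh (by linarith) hup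
  have b₃ := h.cuts_down_le_two (lo := lo) (hi := hi) hf (ham₁.trans hm₁₂) hM hlh (by linarith)
    hdown
  have b₂ : cuts (fun i => Deep G r F lo hi (f i)) m₁ m₂ ≤ 8 := by
    rcases eq_or_lt_of_le hm₁₂ with rfl | hlt
    · exact (cuts_le_sub _ _ _).trans (by omega)
    obtain ⟨j, hj⟩ := union_adj.1 (hM m₁ ham₁ (by omega))
    have hin : ∀ i, m₁ ≤ i → i < m₂ → (F.graph G j).Adj (f i) (f (i + 1)) := by
      intro i hi
      induction i, hi using Nat.le_induction with
      | base => exact fun _ => hj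
      | succ i hi ih =>
        intro hib
        obtain ⟨j', hj'⟩ := union_adj.1 (hM (i + 1) (by omega) (by omega))
        rcases hstep i j j' (by omega) (by omega) (hnotup i (by omega) (by omega))
          (ih (by omega)) hj' with rfl | e
        · exact hj'
        · exact absurd ⟨j', i + 1, hj', by omega, le_rfl, e⟩ (hnd (i + 1) (by omega) hib)
    have hv : ∀ t, m₁ ≤ t → t ≤ m₂ → f t ∈ F.tree j ∪ F.tree' j := by
      intro t h₁ h₂
      rcases eq_or_lt_of_le h₁ with rfl | h₁
      · exact hj.2.1
      · have := (hin (t - 1) (by omega) (by omega)).2.2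
        rwa [Nat.sub_add_cancel (by omega)] at this
    have hf' := hf.mono ham₁ hm₂b
    have c₁ := (h.isHam j).crossCount_le_two h.geod hsp hf' hv
    have c₂ := h.cuts_le_crossCount hlh.le hf' hm₁₂
    omega
  have s₁ := cuts_le_add (fun i => Deep G r F lo hi (f i)) a b m₁
  have s₂ := cuts_le_add (fun i => Deep G r F lo hi (f i)) m₁ b m₂
  omega

/-- A geodesic is cut rarely by the hysteresis set of a window. -/
theorem Setup.cuts_le (h : Setup G T r B F) (hsp : SeriesParallel G) {n : ℕ}
    (hf : Geod G f 0 n) (hlh : lo < hi) (hlen : (n : ℝ) ≤ 2 * (hi - lo)) :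
    cuts (fun i => Deep G r F lo hi (f i)) 0 n ≤ 16 := by
  classical
  by_cases hc : ∀ i, 0 ≤ i → i < n → G.dist r (f i) ≠ G.dist r (f (i + 1))
  · exact (h.cuts_le_two hlh.le hf (Nat.zero_le n) hc).trans (by omega)
  push Not at hc
  have hex : ∃ i, i < n ∧ G.dist r (f i) = G.dist r (f (i + 1)) := by
    obtain ⟨i, -, h₁, h₂⟩ := hc
    exact ⟨i, h₁, h₂⟩
  obtain ⟨c, hcn, hce, hcmin⟩ : ∃ c, c < n ∧ G.dist r (f c) = G.dist r (f (c + 1)) ∧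
      ∀ i < c, G.dist r (f i) ≠ G.dist r (f (i + 1)) :=
    ⟨_, (Nat.find_spec hex).1, (Nat.find_spec hex).2, fun i hi e =>
      Nat.find_min hex hi ⟨by have := (Nat.find_spec hex).1; omega, e⟩⟩
  obtain ⟨d, hcd, hdn, hde, hdmax⟩ : ∃ d, c ≤ d ∧ d < n ∧
      G.dist r (f d) = G.dist r (f (d + 1)) ∧
      ∀ i, d < i → i < n → G.dist r (f i) ≠ G.dist r (f (i + 1)) := by
    set P : ℕ → Prop := fun i => i < n ∧ G.dist r (f i) = G.dist r (f (i + 1))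
    have hPc : P c := ⟨hcn, hce⟩
    have hspec := Nat.findGreatest_spec (P := P) hcn.le hPc
    refine ⟨Nat.findGreatest P n, Nat.le_findGreatest hcn.le hPc, hspec.1, hspec.2, ?_⟩
    intro i h₁ h₂ e
    exact Nat.findGreatest_is_greatest h₁ h₂.le ⟨h₂, e⟩
  -- The piece from the first to the last cross edge is a shortest path that begins and ends with
  -- cross edges, so the decomposition places it in $G[\mathcal H]$.
  have hM : ∀ i, c ≤ i → i < d + 1 → (F.union G).Adj (f i) (f (i + 1)) := by
    obtain ⟨p, he, hs⟩ := exists_walk_of_adj G f c (d + 1 - c)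
      fun i hi => hf.adj (Nat.zero_le _) (by omega)
    have hpl : p.length = d + 1 - c := by
      have := congrArg List.length he
      simpa using this
    have hshort : IsShortestPath G p := by
      have := hf c (c + (d + 1 - c)) (Nat.zero_le _) (by omega) (by omega)
      rw [IsShortestPath]; omega
    obtain ⟨k, hk⟩ : ∃ k, d + 1 - c = k + 1 := ⟨d - c, by omega⟩
    have hcross : ∀ i, G.dist r (f i) = G.dist r (f (i + 1)) → s(f i, f (i + 1)) ∉ T.edgeSet :=
      fun i e he => h.tree.dist_ne_of_adj he e
    have hall := h.dec.crossPaths _ _ p hshort s(f c, f (c + 1)) s(f d, f (d + 1))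
      (by rw [he, hk, List.range_succ_eq_map]; simp)
      (by rw [he, hk, List.range_succ]; simp [show c + k = d by omega])
      (hcross c hce) (hcross d hde)
    intro i hci hid
    have hmem : s(f i, f (i + 1)) ∈ p.edges := by
      rw [he, List.mem_map]
      exact ⟨i - c, by rw [List.mem_range]; omega, by rw [Nat.add_sub_cancel' hci]⟩
    obtain ⟨j, hj⟩ := Set.mem_iUnion.1 (hall _ hmem)
    exact union_adj.2 ⟨j, hj⟩
  have b₁ := h.cuts_le_two (lo := lo) (hi := hi) hlh.le (hf.mono le_rfl hcn.le) (Nat.zero_le c)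
    fun i _ hi => hcmin i hi
  have b₂ := h.cuts_forest_le (lo := lo) (hi := hi) hsp
    (hf.mono (a' := c) (b' := d + 1) (Nat.zero_le c) hdn) (by omega) hM hlh (by
      have h₁ : ((d + 1 : ℕ) : ℝ) ≤ n := Nat.cast_le.2 hdn
      have h₂ : (0 : ℝ) ≤ c := Nat.cast_nonneg c
      linarith)
  have b₃ := h.cuts_le_two (lo := lo) (hi := hi) hlh.le
    (hf.mono (a' := d + 1) (Nat.zero_le _) le_rfl) hdn fun i hi hin => hdmax i hi hin
  have s₁ := cuts_le_add (fun i => Deep G r F lo hi (f i)) 0 n c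
  have s₂ := cuts_le_add (fun i => Deep G r F lo hi (f i)) c n (d + 1)
  omega

end Count

/-! ### The chop -/

section Chop

variable {G T : SimpleGraph V} {r : V} {B : Set V} {F : HammockFamily V ι} {Δ : ℝ}

/-- The vertices beyond the `k`-th boundary of the chop, at depth about `(k + 1) Δ`. -/
def Beyond (G : SimpleGraph V) (r : V) (F : HammockFamily V ι) (Δ : ℝ) (k : ℕ) (v : V) : Prop :=
  Deep G r F (((k : ℝ) + 1) * Δ - Δ / 4) (((k : ℝ) + 1) * Δ + Δ / 4) v

/-- The annuli of the chop. -/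
def annulus (G : SimpleGraph V) (r : V) (F : HammockFamily V ι) (Δ : ℝ) (i : ℕ) : Set V :=
  {v | (∀ k < i, Beyond G r F Δ k v) ∧ ¬ Beyond G r F Δ i v}

theorem Setup.le_dist_of_beyond (h : Setup G T r B F) (hΔ : 1 ≤ Δ) {k : ℕ} {v : V}
    (hv : Beyond G r F Δ k v) : ((k : ℝ) + 1) * Δ - Δ / 4 ≤ G.dist r v :=
  Deep.le_dist h (by linarith) hv

theorem dist_lt_of_not_beyond {k : ℕ} {v : V} (hv : ¬ Beyond G r F Δ k v) :
    (G.dist r v : ℝ) < ((k : ℝ) + 1) * Δ + Δ / 4 :=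
  not_le.1 fun h => hv (.of_le h)

/-- An annulus is indexed by the first boundary not passed, so a partition results without comparing
different boundaries. Half the window width, $\Delta/4$, equals $c\Delta/2$ for $c=1/2$. -/
theorem Setup.isFuzzyChop (h : Setup G T r B F) (hΔ : 1 ≤ Δ) :
    IsFuzzyChop G r (1 / 2) Δ (annulus G r F Δ) where
  partition v := by
    classical
    have hex : ∃ i, ¬ Beyond G r F Δ i v := by
      refine ⟨G.dist r v, fun hv => ?_⟩
      have h₁ := h.le_dist_of_beyond hΔ hv
      have h₂ : (0 : ℝ) ≤ G.dist r v := Nat.cast_nonneg _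
      nlinarith
    refine ⟨Nat.find hex, ⟨fun k hk => not_not.1 (Nat.find_min hex hk), Nat.find_spec hex⟩, ?_⟩
    rintro i ⟨h₁, h₂⟩
    refine le_antisymm ?_ (Nat.find_min' hex h₂)
    by_contra hlt
    exact Nat.find_spec hex (h₁ _ (not_le.1 hlt))
  lower i v hv := by
    cases i with
    | zero =>
      have : (0 : ℝ) ≤ G.dist r v := Nat.cast_nonneg _
      push_cast
      linarith
    | succ i =>
      have := h.le_dist_of_beyond hΔ (hv.1 i (Nat.lt_succ_self i))
      push_cast
      linarith
  upper i v hv := by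
    have := dist_lt_of_not_beyond hv.2
    linarith

theorem Setup.isScattering (h : Setup G T r B F) (hsp : SeriesParallel G) (hΔ : 1 ≤ Δ) :
    IsScattering G Δ 48 (annulus G r F Δ) := by
  classical
  intro u v p hp hlen
  set f : ℕ → V := p.getVert with hfdef
  set n := p.length with hn
  have hf : Geod G f 0 n := by
    intro i j _ hij hj
    have t₁ := h.geod.conn.dist_triangle (u := u) (v := f i) (w := v)
    have t₂ := h.geod.conn.dist_triangle (u := f i) (v := f j) (w := v)
    have l₁ : G.dist u (f i) ≤ i := (G.dist_le (p.take i)).trans (by simp)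
    have l₂ : G.dist (f j) v ≤ n - j := (G.dist_le (p.drop j)).trans (by simp [hn])
    have l₃ : G.dist (f i) (f j) ≤ j - i := by
      have e : (p.drop i).getVert (j - i) = f j := by
        rw [SimpleGraph.Walk.drop_getVert, Nat.add_sub_cancel' hij]
      rw [← e]
      exact (G.dist_le ((p.drop i).take (j - i))).trans (by simp)
    have hp' : n = G.dist u v := hp
    omega
  have hdepth : ∀ i ≤ n, |(G.dist r (f 0) : ℝ) - G.dist r (f i)| ≤ Δ := fun i hi => by
    have h₁ := abs_dist_sub_le (r := r) h.geod hf le_rfl (Nat.zero_le i) hi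
    have h₂ : (i : ℝ) ≤ n := Nat.cast_le.2 hi
    simp only [Nat.cast_zero, sub_zero] at h₁
    exact h₁.trans (h₂.trans hlen)
  set K : Set ℕ := {k | ∃ i < n, ¬ (Beyond G r F Δ k (f i) ↔ Beyond G r F Δ k (f (i + 1)))}
  -- A boundary crossed by the path is within $\Delta/4$ of depths on the path, which are within
  -- $\Delta$ of the initial depth. The resulting half-open interval of length $5\Delta/2$ contains
  -- at most three multiples of $\Delta$.
  have hKd : ∀ k ∈ K, ((k : ℝ) + 1) * Δ ≤ G.dist r (f 0) + 5 / 4 * Δ ∧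
      G.dist r (f 0) - 5 / 4 * Δ < ((k : ℝ) + 1) * Δ := by
    rintro k ⟨i, hi, hne⟩
    have d₁ := abs_le.1 (hdepth i hi.le)
    have d₂ := abs_le.1 (hdepth (i + 1) hi)
    by_cases hb : Beyond G r F Δ k (f i)
    · have hb' : ¬ Beyond G r F Δ k (f (i + 1)) := fun hb' => hne ⟨fun _ => hb', fun _ => hb⟩
      have e₁ := h.le_dist_of_beyond hΔ hb
      have e₂ := dist_lt_of_not_beyond hb'
      constructor <;> linarith [d₁.1, d₁.2, d₂.1, d₂.2]
    · have hb' : Beyond G r F Δ k (f (i + 1)) := by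
        by_contra hb'
        exact hne ⟨fun h => absurd h hb, fun h => absurd h hb'⟩
      have e₁ := h.le_dist_of_beyond hΔ hb'
      have e₂ := dist_lt_of_not_beyond hb
      constructor <;> linarith [d₁.1, d₁.2, d₂.1, d₂.2]
  obtain ⟨k₀, hk₀⟩ : ∃ k₀, ∀ k ∈ K, k ∈ Finset.Icc k₀ (k₀ + 2) := by
    by_cases hne : ∃ k, k ∈ K
    · refine ⟨Nat.find hne, fun k hk => Finset.mem_Icc.2 ⟨Nat.find_min' hne hk, ?_⟩⟩
      have e₁ := (hKd k hk).1
      have e₂ := (hKd _ (Nat.find_spec hne)).2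
      have e₃ : (k : ℝ) < Nat.find hne + 3 := by
        by_contra hge
        have := mul_le_mul_of_nonneg_right (not_lt.1 hge) (by linarith : (0 : ℝ) ≤ Δ)
        linarith
      have : k < Nat.find hne + 3 := by exact_mod_cast e₃
      omega
    · exact ⟨0, fun k hk => absurd ⟨k, hk⟩ hne⟩
  set S : Finset ℕ := (Finset.Icc k₀ (k₀ + 2)).biUnion fun k =>
    (Finset.Ico 0 n).filter fun i => ¬ (Beyond G r F Δ k (f i) ↔ Beyond G r F Δ k (f (i + 1)))
    with hS
  have hScard : S.card ≤ 48 := by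
    refine (Finset.card_biUnion_le_card_mul _ _ 16 fun k _ => ?_).trans (by simp; omega)
    have := h.cuts_le (lo := ((k : ℝ) + 1) * Δ - Δ / 4) (hi := ((k : ℝ) + 1) * Δ + Δ / 4) hsp hf
      (by linarith) (by linarith)
    rw [cuts] at this
    convert this <;> rfl
  have hsub : {e | e ∈ p.edges ∧ IsCut (annulus G r F Δ) e} ⊆
      ((S.image fun i => s(f i, f (i + 1)) : Finset (Sym2 V)) : Set (Sym2 V)) := by
    rintro e ⟨he, x, y, i, j, rfl, hx, hy, hij⟩
    obtain ⟨t, ht, het⟩ := p.mk_mem_edges_iff_exists.1 he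
    rw [Finset.coe_image]
    refine ⟨t, ?_, het⟩
    -- Vertices in different annuli are separated by the boundary whose number is the smaller
    -- annulus index.
    have hsep : ∃ k, ¬ (Beyond G r F Δ k x ↔ Beyond G r F Δ k y) := by
      rcases lt_or_gt_of_ne hij with hlt | hlt
      · exact ⟨i, fun h' => hx.2 (h'.2 (hy.1 i hlt))⟩
      · exact ⟨j, fun h' => hy.2 (h'.1 (hx.1 j hlt))⟩
    obtain ⟨k, hk⟩ := hsep
    have hk' : ¬ (Beyond G r F Δ k (f t) ↔ Beyond G r F Δ k (f (t + 1))) := by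
      rcases Sym2.eq_iff.1 het with ⟨e₁, e₂⟩ | ⟨e₁, e₂⟩
      · rw [hfdef, e₁, e₂]; exact hk
      · rw [hfdef, e₁, e₂]; exact fun h' => hk h'.symm
    rw [Finset.mem_coe, hS, Finset.mem_biUnion]
    refine ⟨k, hk₀ k ⟨t, ht, hk'⟩, ?_⟩
    rw [Finset.mem_filter, Finset.mem_Ico]
    exact ⟨⟨Nat.zero_le t, ht⟩, hk'⟩
  refine (Set.ncard_le_ncard hsub (Finset.finite_toSet _)).trans ?_
  rw [Set.ncard_coe_finset]
  exact Finset.card_image_le.trans hScard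

end Chop

end HammockScattering

open HammockScattering in
theorem mainTheorem5 :
    ∃ (c : ℝ) (τ : ℕ), 0 ≤ c ∧ c < 1 ∧
      ∀ (V ι : Type*) [Finite V] (G T : SimpleGraph V) (r : V) (B : Set V)
        (F : HammockFamily V ι),
        SeriesParallel G → UniqueShortestPaths G → IsBFSTree G T r →
        IsHammockDecomposition G T r B F →
        ∀ Δ : ℝ, 1 ≤ Δ →
          ∃ A : ℕ → Set V, IsFuzzyChop G r c Δ A ∧ IsScattering G Δ τ A := by
  refine ⟨1 / 2, 48, by norm_num, by norm_num, ?_⟩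
  intro V ι _ G T r B F hsp hu hT hdec Δ hΔ
  have h : Setup G T r B F := ⟨hT, hT.uniqueGeod hu, hdec⟩
  exact ⟨_, h.isFuzzyChop hΔ, h.isScattering hsp hΔ⟩
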